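/- **Theorem.** Let $\mathbb K$ be a field of characteristic $0$, $I$ a set and $\mathcal E=\{E_i\}_{i\in I}$ a family of finite sets. An $(I,\mathcal E)$-forest is a finite poset in which every element is covered by at most one element (its parent), with vertices $v$ decorated by $d(v)\in I$ and with each edge from a parent of decoration $i$ to a child decorated by an element of $E_i$; an $(I,\mathcal E)$-tree is a forest $t$ with a greatest element $\operatorname{rt}t$, and $d(t)=d(\operatorname{rt}t)$. Let $\widetilde{\mathcal H}_{I,\mathcal E}$ be the edge-decorated Connes–Kreimer Hopf algebra; as an algebra it is the free vector space on isomorphism classes of $(I,\mathcal E)$-forests, with disjoint union as product. Let $\tilde B_+^{(i)}\colon\widetilde{\mathcal H}_{I,\mathcal E}^{\otimes E_i}\to\widetilde{\mathcal H}_{I,\mathcal E}$ be the linear map sending $\bigotimes_{e\in E_i}f_e$ to the tree obtained by adding a root of decoration $i$, joined to the root of each component of $f_e$ by an edge of decoration $e$. For each $i\in I$ let $\Lambda_i\colon\mathbb K[L_e: e\in E_i]\to\mathbb K[L]$ be a 1-cocycle, i.e. a linear map with $\Delta\Lambda_i=\Lambda_i\otimes1+(\mathrm{id}\otimes\Lambda_i)\delta$,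 where $\Delta$ is the algebra morphism with $\Delta L=1\otimes L+L\otimes 1$ and $\delta\mathbf L^\alpha=\sum_{\beta\le\alpha}\binom{\alpha}{\beta}L^{|\alpha|-|\beta|}\otimes\mathbf L^\beta$. Then: 1. There is a unique family of coefficients $a_{i,\alpha}\in\mathbb K$ ($i\in I$, $\alpha\in\mathbb Z_{\ge0}^{E_i}$) such that, with $$A_i(\mathbf L_i)=\sum_{\alpha}a_{i,\alpha}\binom{|\alpha|}{\alpha}\mathbf L_i^\alpha ,$$ one has $\Lambda_i f=\int_0^L A_i(\partial/\partial u_e: e\in E_i)\,f\,\big|_{u_e=u\ \forall e}\,du$ for all $i$ and all polynomials $f$. 2. There is a unique algebra morphism $\phi\colon\widetilde{\mathcal H}_{I,\mathcal E}\to\mathbb K[L]$ with $\phi\tilde B_+^{(i)}=\Lambda_i\,\phi^{\otimes E_i}$ for all $i\in I$, where $\mathbb K[L]^{\otimes E_i}$ is identified with $\mathbb K[L_e: e\in E_i]$. 3. For every $(I,\mathcal E)$-tree $t$, $$\phi(t)=\sum_{\tau\in\mathrm{Tub}(t)}\operatorname{mel}(\tau)\sum_{k=1}^{b(\tau)}a_{d(t),\beta^k(\tau)}\frac{L^k}{k!}.$$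 Here a *tube* of $t$ is a nonempty connected convex subset; for tubes $X,Y$ write $X\to Y$ if they are disjoint and $x<y$ for some $x\in X$, $y\in Y$; a *tubing* is a set of tubes, any two of which are disjoint or nested, without a cycle $X_1\to\dots\to X_k\to X_1$. $\mathrm{Tub}(t)$ is the set of binary tubings, i.e. tubings maximal under inclusion. The parent of a tube $X\in\tau$ is the smallest tube of $\tau$ properly containing it; $X$ is an *upper* (*lower*) tube if it is an upset (downset) in its parent, and $t$ itself is also a lower tube. The lower tube corresponding to an upper tube $X$ is the lower tube $Y\in\tau$ disjoint from $X$ with $X\cup Y\in\tau$, and the *type* of $X$ is the decoration of the first edge on the path from the root of $X$ to the root of $Y$. The rank vector $\mathbf{rk}(\tau,v)\in\mathbb Z_{\ge0}^{E_{d(v)}}$ has as $e$-th entry the number of upper tubes of type $e$ rooted at $v$; $\operatorname{mel}(\tau)=\prod_{v\ne\operatorname{rt}t}a_{d(v),\mathbf{rk}(\tau,v)}$; $b(\tau)$ is the number of tubes of $\tau$ containing $\operatorname{rt}t$; and $\beta^k(\tau)\in\mathbb Z_{\ge0}^{E_{d(t)}}$ has as $e$-th entry the number of upper tubes of type $e$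 containing $\operatorname{rt}t$, not counting the outermost $k-1$ upper tubes containing $\operatorname{rt}t$. -/

import Mathlib

open scoped TensorProduct Polynomial

universe u v

/-! ### Decorated rooted forests and trees, as finite posets -/

/-- An `(I, E)`-forest: a finite poset in which every element is covered by at most one element,
with vertices decorated by `I` and each edge `x ⋖ y` (`y` is the parent of `x`) decorated by an
element of `E i`, where `i` is the decoration of the parent `y`. -/
structure DecForest (I : Type u) (E : I → Type v) where
  V : Type v
  [fintype : Fintype V]
  [order : PartialOrder V]
  forest : ∀ x y z : V, x ⋖ y → x ⋖ z → y = z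
  vdec : V → I
  edec : ∀ x y : V, x ⋖ y → E (vdec y)

attribute [instance] DecForest.fintype DecForest.order

/-- An `(I, E)`-tree: a forest with a root, i.e. an element above all others. -/
structure DecTree (I : Type u) (E : I → Type v) extends DecForest I E where
  root : V
  le_root : ∀ x : V, x ≤ root

namespace DecForest

variable {I : Type u} {E : I → Type v}

/-- The decoration of an edge, together with the decoration of the parent vertex. -/
def edge (A : DecForest I E) {x y : A.V} (h : x ⋖ y) : Σ i, E i := ⟨A.vdec y, A.edec x y h⟩

/-- Isomorphism of forests: an order isomorphism preserving vertex and edge decorations. -/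
def Iso (A B : DecForest I E) : Prop :=
  ∃ f : A.V ≃o B.V, (∀ x, B.vdec (f x) = A.vdec x) ∧
    ∀ (x y : A.V) (h : x ⋖ y) (h' : f x ⋖ f y), B.edge h' = A.edge h

theorem Iso.refl (A : DecForest I E) : Iso A A :=
  ⟨OrderIso.refl _, fun _ => rfl, fun _ _ _ _ => rfl⟩

theorem Iso.symm {A B : DecForest I E} : Iso A B → Iso B A := by
  rintro ⟨f, hv, he⟩
  refine ⟨f.symm, fun x => ?_, fun x y h h' => ?_⟩
  · rw [← hv, f.apply_symm_apply]
  · obtain ⟨x, rfl⟩ := f.surjective x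
    obtain ⟨y, rfl⟩ := f.surjective y
    have h2 : x ⋖ y := by simpa using h'
    rw [he x y h2 h]
    congr 1 <;> simp

theorem Iso.trans {A B C : DecForest I E} : Iso A B → Iso B C → Iso A C := by
  rintro ⟨f, hv, he⟩ ⟨g, gv, ge⟩
  refine ⟨f.trans g, fun x => (gv _).trans (hv x), fun x y h h' => ?_⟩
  have h2 : f x ⋖ f y := (apply_covBy_apply_iff f).2 h
  exact (ge _ _ h2 h').trans (he _ _ h h2)

instance setoid (I : Type u) (E : I → Type v) : Setoid (DecForest I E) where
  r := Iso
  iseqv := ⟨Iso.refl, Iso.symm, Iso.trans⟩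

/-- The empty forest. -/
def empty (I : Type u) (E : I → Type v) : DecForest I E where
  V := PEmpty
  forest := fun x => x.elim
  vdec := fun x => x.elim
  edec := fun x => x.elim

section Sum
variable {α β : Type*} [PartialOrder α] [PartialOrder β]

theorem covBy_of_inl {a b : α} (h : (Sum.inl a : α ⊕ β) ⋖ Sum.inl b) : a ⋖ b :=
  ⟨Sum.inl_lt_inl_iff.1 h.1, fun _ h1 h2 =>
    h.2 (Sum.inl_lt_inl_iff.2 h1) (Sum.inl_lt_inl_iff.2 h2)⟩

theorem covBy_of_inr {a b : β} (h : (Sum.inr a : α ⊕ β) ⋖ Sum.inr b) : a ⋖ b :=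
  ⟨Sum.inr_lt_inr_iff.1 h.1, fun _ h1 h2 =>
    h.2 (Sum.inr_lt_inr_iff.2 h1) (Sum.inr_lt_inr_iff.2 h2)⟩

end Sum

/-- Disjoint union of two forests. -/
def union (A B : DecForest I E) : DecForest I E where
  V := A.V ⊕ B.V
  forest := by
    rintro (x | x) (y | y) (z | z) h h'
    · rw [A.forest x y z (covBy_of_inl h) (covBy_of_inl h')]
    · exact absurd h'.1 Sum.not_inl_lt_inr
    · exact absurd h.1 Sum.not_inl_lt_inr
    · exact absurd h.1 Sum.not_inl_lt_inr
    · exact absurd h.1 Sum.not_inr_lt_inl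
    · exact absurd h.1 Sum.not_inr_lt_inl
    · exact absurd h'.1 Sum.not_inr_lt_inl
    · rw [B.forest x y z (covBy_of_inr h) (covBy_of_inr h')]
  vdec := Sum.elim A.vdec B.vdec
  edec := fun x y => match x, y with
    | Sum.inl x, Sum.inl y => fun h => A.edec x y (covBy_of_inl h)
    | Sum.inr x, Sum.inr y => fun h => B.edec x y (covBy_of_inr h)
    | Sum.inl _, Sum.inr _ => fun h => absurd h.1 Sum.not_inl_lt_inr
    | Sum.inr _, Sum.inl _ => fun h => absurd h.1 Sum.not_inr_lt_inl

theorem union_congr {A A' B B' : DecForest I E} :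
    Iso A A' → Iso B B' → Iso (A.union B) (A'.union B') := by
  rintro ⟨f, fv, fe⟩ ⟨g, gv, ge⟩
  refine ⟨OrderIso.sumCongr f g, ?_, ?_⟩
  · rintro (x | x)
    · exact fv x
    · exact gv x
  · rintro (x | x) (y | y) h h'
    · exact fe x y (covBy_of_inl h) (covBy_of_inl h')
    · exact absurd h.1 Sum.not_inl_lt_inr
    · exact absurd h.1 Sum.not_inr_lt_inl
    · exact ge x y (covBy_of_inr h) (covBy_of_inr h')

theorem union_comm (A B : DecForest I E) : Iso (A.union B) (B.union A) := by
  refine ⟨OrderIso.sumComm _ _, ?_, ?_⟩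
  · rintro (x | x) <;> rfl
  · rintro (x | x) (y | y) h h'
    · rfl
    · exact absurd h.1 Sum.not_inl_lt_inr
    · exact absurd h.1 Sum.not_inr_lt_inl
    · rfl

theorem union_assoc (A B C : DecForest I E) :
    Iso ((A.union B).union C) (A.union (B.union C)) := by
  refine ⟨OrderIso.sumAssoc _ _ _, ?_, ?_⟩
  · rintro ((x | x) | x) <;> rfl
  · rintro ((x | x) | x) ((y | y) | y) h h'
    · rfl
    · exact absurd h'.1 Sum.not_inl_lt_inr
    · exact absurd h'.1 Sum.not_inl_lt_inr
    · exact absurd h'.1 Sum.not_inr_lt_inl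
    · rfl
    · exact absurd h.1 Sum.not_inl_lt_inr
    · exact absurd h'.1 Sum.not_inr_lt_inl
    · exact absurd h.1 Sum.not_inr_lt_inl
    · rfl

theorem empty_union (A : DecForest I E) : Iso ((empty I E).union A) A := by
  refine ⟨⟨Equiv.emptySum PEmpty A.V, ?_⟩, ?_, ?_⟩
  · rintro (x | x) (y | y)
    · exact x.elim
    · exact x.elim
    · exact y.elim
    · exact Sum.inr_le_inr_iff.symm
  · rintro (x | x)
    · exact x.elim
    · rfl
  · rintro (x | x) (y | y) h h'
    · exact x.elim
    · exact x.elim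
    · exact y.elim
    · rfl

section Node
variable {ι : Type*} {α : ι → Type*} [∀ i, PartialOrder (α i)]

theorem fst_eq_of_covBy {x y : Σ i, α i} (h : (x : WithTop (Σ i, α i)) ⋖ y) : x.1 = y.1 :=
  (Sigma.lt_def.1 (WithTop.coe_lt_coe.1 h.1)).fst

theorem covBy_of_coe {i : ι} {a b : α i}
    (h : ((⟨i, a⟩ : Σ i, α i) : WithTop (Σ i, α i)) ⋖ ((⟨i, b⟩ : Σ i, α i) : WithTop _)) :
    a ⋖ b :=
  ⟨Sigma.mk_lt_mk_iff.1 (WithTop.coe_lt_coe.1 h.1), fun _ h1 h2 =>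
    h.2 (WithTop.coe_lt_coe.2 (Sigma.mk_lt_mk_iff.2 h1))
      (WithTop.coe_lt_coe.2 (Sigma.mk_lt_mk_iff.2 h2))⟩

end Node

/-- The tree obtained from the forests `F e`, `e ∈ E i`, by adding a new root of decoration `i`,
joined to the root of each component of `F e` by an edge of decoration `e`. -/
def graft (i : I) [Fintype (E i)] (F : E i → DecForest I E) : DecTree I E where
  V := WithTop (Σ e, (F e).V)
  fintype := (inferInstance : Fintype (Option (Σ e, (F e).V)))
  forest := by
    intro x y z h h'
    induction x using WithTop.recTopCoe with
    | top => exact absurd h.1 not_top_lt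
    | coe x =>
      induction y using WithTop.recTopCoe with
      | top =>
        induction z using WithTop.recTopCoe with
        | top => rfl
        | coe z => exact absurd (WithTop.coe_lt_top z) (h.2 h'.1)
      | coe y =>
        induction z using WithTop.recTopCoe with
        | top => exact absurd (WithTop.coe_lt_top y) (h'.2 h.1)
        | coe z =>
          obtain ⟨e, x⟩ := x
          obtain ⟨e1, y⟩ := y
          obtain ⟨e2, z⟩ := z
          obtain rfl : e = e1 := fst_eq_of_covBy h
          obtain rfl : e = e2 := fst_eq_of_covBy h'
          rw [(F e).forest x y z (covBy_of_coe (α := fun e => (F e).V) h)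
            (covBy_of_coe (α := fun e => (F e).V) h')]
  vdec := fun x => match x with
    | none => i
    | some x => (F x.1).vdec x.2
  edec := fun x y => match x, y with
    | none, _ => fun h => absurd h.1 not_top_lt
    | some x, none => fun _ => x.1
    | some ⟨_, x⟩, some ⟨e', y⟩ => fun h =>
        have he := fst_eq_of_covBy h
        (F e').edec (cast (congrArg (fun e => (F e).V) he) x) y (by cases he; exact covBy_of_coe (α := fun e => (F e).V) h)
  root := ⊤
  le_root := fun _ => le_top

end DecForest

/-- Isomorphism classes of `(I, E)`-forests. -/
def ForestClass (I : Type u) (E : I → Type v) := Quotient (DecForest.setoid I E)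

namespace ForestClass

variable {I : Type u} {E : I → Type v}

/-- The isomorphism class of a forest. -/
def mk (A : DecForest I E) : ForestClass I E := Quotient.mk _ A

/-- Isomorphism classes of forests form a commutative monoid under disjoint union. -/
instance : CommMonoid (ForestClass I E) where
  mul := Quotient.map₂ DecForest.union fun _ _ h _ _ h' => DecForest.union_congr h h'
  one := mk (DecForest.empty I E)
  mul_assoc := by
    rintro ⟨A⟩ ⟨B⟩ ⟨C⟩
    exact Quotient.sound (DecForest.union_assoc A B C)
  mul_comm := by
    rintro ⟨A⟩ ⟨B⟩
    exact Quotient.sound (DecForest.union_comm A B)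
  one_mul := by
    rintro ⟨A⟩
    exact Quotient.sound (DecForest.empty_union A)
  mul_one := by
    rintro ⟨A⟩
    exact Quotient.sound ((DecForest.union_comm _ _).trans (DecForest.empty_union A))

/-- Grafting of isomorphism classes of forests, computed on representatives. -/
noncomputable def graft (i : I) [Fintype (E i)] (F : E i → ForestClass I E) : ForestClass I E :=
  mk (DecForest.graft i fun e => (F e).out).toDecForest

/-- Grafting respects isomorphism. -/
theorem graft_congr (i : I) [Fintype (E i)]
    {F G : E i → DecForest I E} (hFG : ∀ e, DecForest.Iso (F e) (G e)) :
    DecForest.Iso (DecForest.graft i F).toDecForest (DecForest.graft i G).toDecForest := by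
  choose f hv he using hFG
  let g : (Σ e, (F e).V) ≃o (Σ e, (G e).V) :=
    { Equiv.sigmaCongrRight fun e => (f e).toEquiv with
      map_rel_iff' := by
        rintro ⟨e, x⟩ ⟨e', y⟩
        constructor
        · intro h
          have h1 := (Sigma.le_def.1 h).fst
          change e = e' at h1
          subst h1
          exact Sigma.mk_le_mk_iff.2 ((f e).le_iff_le.1
            ((Sigma.mk_le_mk_iff (α := fun e => (G e).V)).1 h))
        · rintro ⟨_, _, _, h⟩
          exact Sigma.mk_le_mk_iff.2 ((f e).le_iff_le.2 h) }
  refine ⟨g.withTopCongr, ?_, ?_⟩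
  · rintro (_ | ⟨e, x⟩)
    · rfl
    · exact hv e x
  · rintro (_ | ⟨e, x⟩) (_ | ⟨e', y⟩) h h'
    · exact absurd h.1 (lt_irrefl _)
    · exact absurd h.1 (show ¬ (⊤ : WithTop (Σ e, (F e).V)) < _ from not_top_lt)
    · rfl
    · have h1 : e = e' := DecForest.fst_eq_of_covBy h
      subst h1
      exact he e x y (DecForest.covBy_of_coe (α := fun e => (F e).V) h)
        (DecForest.covBy_of_coe (α := fun e => (G e).V) h')

/-- Grafting of classes does not depend on the representatives. -/
theorem graft_mk (i : I) [Fintype (E i)] (F : E i → DecForest I E) :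
    ForestClass.graft i (fun e => ForestClass.mk (F e)) =
      ForestClass.mk (DecForest.graft i F).toDecForest :=
  Quotient.sound (graft_congr i fun e => Quotient.exact (Quotient.out_eq (ForestClass.mk (F e))))

end ForestClass

/-- The algebra underlying the edge-decorated Connes-Kreimer Hopf algebra: the free vector space
on isomorphism classes of `(I, E)`-forests, with disjoint union as multiplication. -/
abbrev CKAlgebra (K : Type*) [Field K] (I : Type u) (E : I → Type v) :=
  MonoidAlgebra K (ForestClass I E)

namespace CKAlgebra

variable (K : Type*) [Field K] {I : Type u} {E : I → Type v}

/-- A forest as an element of the algebra. -/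
noncomputable def ofForest (A : DecForest I E) : CKAlgebra K I E :=
  MonoidAlgebra.of K _ (ForestClass.mk A)

/-- The basis of forests. -/
noncomputable def basis (I : Type u) (E : I → Type v) :
    Module.Basis (ForestClass I E) K (CKAlgebra K I E) := MonoidAlgebra.basis _ K

/-- The operator adding a root of decoration `i`: on basis vectors it sends `⨂ e, F e` to the tree
`graft i F`. -/
noncomputable def Bplus (i : I) [Fintype (E i)] :
    (⨂[K] _ : E i, CKAlgebra K I E) →ₗ[K] CKAlgebra K I E :=
  (Basis.piTensorProduct fun _ : E i => basis K I E).constr K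
    fun F => MonoidAlgebra.of K _ (ForestClass.graft i F)

/-- `Bplus i` sends a tensor product of forests to the grafted tree. -/
theorem Bplus_tprod (i : I) [Fintype (E i)]
    (F : E i → DecForest I E) :
    Bplus K i (PiTensorProduct.tprod K fun e => ofForest K (F e)) =
      ofForest K (DecForest.graft i F).toDecForest := by
  have := (Basis.piTensorProduct fun _ : E i => basis K I E).constr_basis K
    (fun F => MonoidAlgebra.of K _ (ForestClass.graft i F)) (fun e => ForestClass.mk (F e))
  rw [Basis.piTensorProduct_apply] at this
  rw [ofForest, ← ForestClass.graft_mk, ← this]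
  rfl

end CKAlgebra

/-! ### 1-cocycles with values in the polynomial Hopf algebra `K[L]` -/

section Cocycles

variable {K : Type*} [Field K] {ε : Type*} [Fintype ε]

/-- The coproduct of `K[L]`: the algebra morphism with `L ↦ 1 ⊗ L + L ⊗ 1`. -/
noncomputable def polyComul : K[X] →ₐ[K] K[X] ⊗[K] K[X] :=
  Polynomial.aeval (1 ⊗ₜ Polynomial.X + Polynomial.X ⊗ₜ 1)

open Classical in
/-- The coaction of `K[L]` on `K[L_e : e ∈ ε]`, i.e. on the tensor power `K[L]^{⊗ ε}`:
`L^α ↦ ∑_{β ≤ α} (α choose β) L^{|α| - |β|} ⊗ L^β`. -/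
noncomputable def polyCoaction :
    MvPolynomial ε K →ₗ[K] K[X] ⊗[K] MvPolynomial ε K :=
  (MvPolynomial.basisMonomials ε K).constr K fun α =>
    ∑ β ∈ Finset.Iic α, ((∏ e, (α e).choose (β e) : ℕ) : K) •
      ((Polynomial.X ^ (α.degree - β.degree) : K[X]) ⊗ₜ MvPolynomial.monomial β (1 : K))

/-- The 1-cocycle condition `Δ Λ = Λ ⊗ 1 + (id ⊗ Λ) δ`. -/
def IsOneCocycle (Λ : MvPolynomial ε K →ₗ[K] K[X]) : Prop :=
  ∀ f, polyComul (K := K) (Λ f) = Λ f ⊗ₜ 1 + TensorProduct.map LinearMap.id Λ (polyCoaction f)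

/-- The iterated partial derivative `∂^α`, given on monomials. -/
noncomputable def iterPDeriv (α : ε →₀ ℕ) : MvPolynomial ε K →ₗ[K] MvPolynomial ε K :=
  (MvPolynomial.basisMonomials ε K).constr K fun γ =>
    MvPolynomial.monomial (γ - α) ((∏ e, (γ e).descFactorial (α e) : ℕ) : K)

open Classical in
/-- The differential operator `A(∂) = ∑_α A_α ∂^α` of a power series `A`. On the monomial of
exponent `γ`, the terms with `¬ α ≤ γ` vanish and are left out. -/
noncomputable def diffOp (A : MvPowerSeries ε K) : MvPolynomial ε K →ₗ[K] MvPolynomial ε K :=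
  (MvPolynomial.basisMonomials ε K).constr K fun γ =>
    ∑ α ∈ Finset.Iic γ, MvPowerSeries.coeff α A • iterPDeriv α (MvPolynomial.monomial γ 1)

/-- The integration operator `f ↦ ∫_0^L f(u) du`. -/
noncomputable def polyIntegral : K[X] →ₗ[K] K[X] :=
  (Polynomial.basisMonomials K).constr K fun n => Polynomial.monomial (n + 1) (1 / ((n : K) + 1))

/-- The operator `f ↦ ∫_0^L A(∂/∂u_e : e ∈ ε) f |_{u_e = u for all e} du`. -/
noncomputable def seriesCocycle (A : MvPowerSeries ε K) : MvPolynomial ε K →ₗ[K] K[X] :=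
  polyIntegral ∘ₗ (MvPolynomial.aeval fun _ : ε => (Polynomial.X : K[X])).toLinearMap ∘ₗ diffOp A

/-- The series `∑_α a_α (|α| choose α) L^α`. -/
noncomputable def multinomialSeries (a : (ε →₀ ℕ) → K) : MvPowerSeries ε K :=
  fun α => a α * (α.multinomial : K)

/-- The identification of `K[L]^{⊗ ε}` with `K[L_e : e ∈ ε]`. -/
noncomputable def tensorToPoly : (⨂[K] _ : ε, K[X]) →ₗ[K] MvPolynomial ε K :=
  PiTensorProduct.lift <|
    (MultilinearMap.mkPiAlgebra K ε (MvPolynomial ε K)).compLinearMap fun e =>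
      (Polynomial.aeval (MvPolynomial.X e : MvPolynomial ε K)).toLinearMap

end Cocycles

/-! ### Binary tubings -/

section Tubings

variable {P : Type*} [Fintype P] [PartialOrder P]

/-- A tube: a connected (in particular nonempty) convex subset. -/
def IsTube (X : Finset P) : Prop :=
  (X : Set P).OrdConnected ∧
    ((SimpleGraph.fromRel fun x y : P => x ≤ y).induce (X : Set P)).Connected

/-- The relation `X → Y` on tubes. -/
def TubeArrow (X Y : Finset P) : Prop :=
  Disjoint X Y ∧ ∃ x ∈ X, ∃ y ∈ Y, x < y

/-- A tubing: a laminar and acyclic collection of tubes. -/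
structure IsTubing (τ : Finset (Finset P)) : Prop where
  tube : ∀ X ∈ τ, IsTube X
  laminar : ∀ X ∈ τ, ∀ Y ∈ τ, Disjoint X Y ∨ X ⊆ Y ∨ Y ⊆ X
  acyclic : ∀ X ∈ τ, ¬ Relation.TransGen (fun Y Z => Y ∈ τ ∧ Z ∈ τ ∧ TubeArrow Y Z) X X

open Classical in
/-- The binary tubings of `P`: the maximal ones. -/
noncomputable def Tub (P : Type*) [Fintype P] [PartialOrder P] : Finset (Finset (Finset P)) :=
  Finset.univ.filter fun τ => Maximal IsTubing τ

/-- `Q` is the parent of `X` in the tree of tubes: the smallest tube properly containing `X`. -/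
def IsParentTube (τ : Finset (Finset P)) (X Q : Finset P) : Prop :=
  Q ∈ τ ∧ X ⊂ Q ∧ ∀ Z ∈ τ, X ⊂ Z → Q ⊆ Z

/-- An upper tube: a tube which is an upset in its parent. -/
def IsUpperTube (τ : Finset (Finset P)) (X : Finset P) : Prop :=
  X ∈ τ ∧ ∃ Q, IsParentTube τ X Q ∧ ∀ x ∈ X, ∀ y ∈ Q, x ≤ y → y ∈ X

/-- A lower tube: a tube which is a downset in its parent, or the whole poset. -/
def IsLowerTube (τ : Finset (Finset P)) (X : Finset P) : Prop :=
  X ∈ τ ∧ (X = Finset.univ ∨ ∃ Q, IsParentTube τ X Q ∧ ∀ x ∈ X, ∀ y ∈ Q, y ≤ x → y ∈ X)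

end Tubings

/-! ### Statistics of binary tubings -/

namespace DecTree

variable {I : Type u} {E : I → Type v} (t : DecTree I E) (τ : Finset (Finset t.V))

open Classical in
/-- `X` is an upper tube with root `v` and type `e`: if `Y` is the corresponding lower tube (the one
with which `X` forms a disjoint union that is a tube of `τ`) and `w` is the root of `Y`, then `e` is
the decoration of the first edge on the path from `v` down to `w`; this is the edge from `v` to its
child `c` with `w ≤ c`. -/
def IsUpperOfType (X : Finset t.V) (v : t.V) (e : E (t.vdec v)) : Prop :=
  IsUpperTube τ X ∧ IsGreatest (X : Set t.V) v ∧
    ∃ Y, IsLowerTube τ Y ∧ Disjoint X Y ∧ X ∪ Y ∈ τ ∧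
      ∃ (w c : t.V) (h : c ⋖ v), IsGreatest (Y : Set t.V) w ∧ w ≤ c ∧ t.edec c v h = e

variable [∀ i, Fintype (E i)]

open Classical in
/-- The rank vector of `v`: its `e`-th entry is the number of upper tubes of type `e` rooted
at `v`. -/
noncomputable def rk (v : t.V) : E (t.vdec v) →₀ ℕ :=
  Finsupp.equivFunOnFinite.symm fun e => (τ.filter fun X => t.IsUpperOfType τ X v e).card

open Classical in
/-- The number of tubes containing the root. -/
noncomputable def b : ℕ := (τ.filter fun X => t.root ∈ X).card

open Classical in
/-- The `k`-th `β`-vector (`k ≥ 1`): its `e`-th entry is the number of upper tubes of type `e`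
rooted at the root of `t`, excluding the outermost `k - 1` upper tubes containing the root; a tube
is kept if at least `k - 1` upper tubes containing the root are strictly larger. -/
noncomputable def betaVec (k : ℕ) : E (t.vdec t.root) →₀ ℕ :=
  Finsupp.equivFunOnFinite.symm fun e => (τ.filter fun X => t.IsUpperOfType τ X t.root e ∧
    k - 1 ≤ (τ.filter fun Z => IsUpperTube τ Z ∧ t.root ∈ Z ∧ X ⊂ Z).card).card

open Classical in
/-- The Mellin monomial. -/
noncomputable def mel {K : Type*} [Field K] (a : ∀ i, (E i →₀ ℕ) → K) : K :=
  ∏ v ∈ Finset.univ.filter fun v => v ≠ t.root, a (t.vdec v) (t.rk τ v)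

end DecTree

/-! ### Polynomial 1-cocycles -/

section CocycleLemmas

variable {K : Type*} [Field K] {ε : Type*}

theorem Finsupp.eq_of_le_of_degree_le {α β : ε →₀ ℕ} (h : β ≤ α) (hd : α.degree ≤ β.degree) :
    β = α := by
  have h1 : α.degree = (α - β).degree + β.degree := by
    rw [← map_add, tsub_add_cancel_of_le h]
  have h2 : α - β = 0 := (Finsupp.degree_eq_zero_iff _).1 (by omega)
  exact le_antisymm h (tsub_eq_zero_iff_le.1 h2)

theorem Polynomial.ext_of_derivative [CharZero K] {p q : K[X]}
    (h : p.derivative = q.derivative) (h0 : p.coeff 0 = q.coeff 0) : p = q := by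
  have h1 : (p - q).derivative = 0 := by rw [Polynomial.derivative_sub, h, sub_self]
  have h2 := Polynomial.eq_C_of_derivative_eq_zero h1
  rw [Polynomial.coeff_sub, h0, sub_self, map_zero] at h2
  exact sub_eq_zero.1 h2

open Classical in
theorem coeff_zero_sum_Iic (γ : ε →₀ ℕ) (g : (ε →₀ ℕ) → K) :
    (∑ β ∈ Finset.Iic γ, g β • (Polynomial.X ^ (γ.degree - β.degree) : K[X])).coeff 0 = g γ := by
  rw [Polynomial.finsetSum_coeff, Finset.sum_eq_single γ]
  · simp
  · intro β hβ hne
    have h1 : ¬ γ.degree ≤ β.degree :=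
      fun h => hne (Finsupp.eq_of_le_of_degree_le (Finset.mem_Iic.1 hβ) h)
    rw [Polynomial.coeff_smul, Polynomial.coeff_X_pow, if_neg (by omega), smul_zero]
  · simp

variable [Fintype ε]

/-- The contraction `p ⊗ f ↦ ℓ f • p`. -/
noncomputable def sliceRight {M : Type*} [AddCommGroup M] [Module K M] (l : M →ₗ[K] K) :
    K[X] ⊗[K] M →ₗ[K] K[X] :=
  (TensorProduct.rid K K[X]).toLinearMap ∘ₗ TensorProduct.map LinearMap.id l

@[simp] theorem sliceRight_tmul {M : Type*} [AddCommGroup M] [Module K M] (l : M →ₗ[K] K)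
    (p : K[X]) (m : M) : sliceRight l (p ⊗ₜ m) = l m • p := by
  simp [sliceRight]

theorem sliceRight_map {M N : Type*} [AddCommGroup M] [Module K M] [AddCommGroup N]
    [Module K N] (l : N →ₗ[K] K) (g : M →ₗ[K] N) (z : K[X] ⊗[K] M) :
    sliceRight l (TensorProduct.map LinearMap.id g z) = sliceRight (l ∘ₗ g) z := by
  induction z with
  | zero => simp
  | tmul p m => simp
  | add x y hx hy => simp [hx, hy]

theorem sliceRight_coeff_zero_mul (z : K[X] ⊗[K] K[X]) :
    sliceRight (Polynomial.lcoeff K 0) ((1 ⊗ₜ Polynomial.X + Polynomial.X ⊗ₜ 1) * z) =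
      Polynomial.X * sliceRight (Polynomial.lcoeff K 0) z := by
  induction z with
  | zero => simp
  | tmul p q => simp [add_mul]
  | add x y hx hy => rw [mul_add, map_add, hx, hy, map_add, mul_add]

theorem sliceRight_coeff_one_mul (z : K[X] ⊗[K] K[X]) :
    sliceRight (Polynomial.lcoeff K 1) ((1 ⊗ₜ Polynomial.X + Polynomial.X ⊗ₜ 1) * z) =
      Polynomial.X * sliceRight (Polynomial.lcoeff K 1) z +
        sliceRight (Polynomial.lcoeff K 0) z := by
  induction z with
  | zero => simp
  | tmul p q => simp [add_mul, Polynomial.coeff_X_mul, add_comm]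
  | add x y hx hy => rw [mul_add, map_add, hx, hy, map_add, map_add]; ring

theorem sliceRight_coeff_zero_polyComul (p : K[X]) :
    sliceRight (Polynomial.lcoeff K 0) (polyComul (K := K) p) = p := by
  induction p using Polynomial.induction_on' with
  | add p q hp hq => rw [map_add, map_add, hp, hq]
  | monomial n a =>
    rw [← mul_one a, ← smul_eq_mul, ← Polynomial.smul_monomial, map_smul, map_smul]
    congr 1
    rw [Polynomial.monomial_one_right_eq_X_pow]
    induction n with
    | zero => simp [Algebra.TensorProduct.one_def]
    | succ n ih =>
      rw [pow_succ', map_mul]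
      nth_rewrite 1 [polyComul]
      rw [Polynomial.aeval_X, sliceRight_coeff_zero_mul, ih]

theorem sliceRight_coeff_one_polyComul (p : K[X]) :
    sliceRight (Polynomial.lcoeff K 1) (polyComul (K := K) p) = p.derivative := by
  induction p using Polynomial.induction_on' with
  | add p q hp hq => rw [map_add, map_add, hp, hq, map_add]
  | monomial n a =>
    rw [← mul_one a, ← smul_eq_mul, ← Polynomial.smul_monomial, map_smul, map_smul,
      Polynomial.derivative_smul]
    congr 1
    rw [Polynomial.monomial_one_right_eq_X_pow]
    induction n with
    | zero => simp [Algebra.TensorProduct.one_def, Polynomial.coeff_one]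
    | succ n ih =>
      rw [pow_succ', map_mul]
      nth_rewrite 1 [polyComul]
      rw [Polynomial.aeval_X, sliceRight_coeff_one_mul, ih,
        sliceRight_coeff_zero_polyComul, Polynomial.derivative_mul, Polynomial.derivative_X]
      ring

open Classical in
theorem sliceRight_polyCoaction (l : MvPolynomial ε K →ₗ[K] K) (γ : ε →₀ ℕ) :
    sliceRight l (polyCoaction (MvPolynomial.monomial γ (1 : K))) =
      ∑ β ∈ Finset.Iic γ, (((∏ e, (γ e).choose (β e) : ℕ) : K) *
        l (MvPolynomial.monomial β 1)) • (Polynomial.X ^ (γ.degree - β.degree) : K[X]) := by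
  have h := (MvPolynomial.basisMonomials ε K).constr_basis K (fun α =>
    ∑ β ∈ Finset.Iic α, ((∏ e, (α e).choose (β e) : ℕ) : K) •
      ((Polynomial.X ^ (α.degree - β.degree) : K[X]) ⊗ₜ[K]
        MvPolynomial.monomial β (1 : K))) γ
  rw [MvPolynomial.coe_basisMonomials] at h
  rw [polyCoaction, h, map_sum]
  simp only [map_smul, sliceRight_tmul, smul_smul]

theorem IsOneCocycle.coeff_zero {Λ : MvPolynomial ε K →ₗ[K] K[X]} (h : IsOneCocycle Λ)
    (f : MvPolynomial ε K) : (Λ f).coeff 0 = 0 := by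
  have key : Polynomial.lcoeff K 0 ∘ₗ Λ = 0 := by
    refine (MvPolynomial.basisMonomials ε K).ext fun γ => ?_
    rw [MvPolynomial.coe_basisMonomials]
    have h1 := congrArg (sliceRight (Polynomial.lcoeff K 0))
      (h (MvPolynomial.monomial γ 1))
    rw [sliceRight_coeff_zero_polyComul, map_add, sliceRight_map, sliceRight_tmul,
      sliceRight_polyCoaction] at h1
    simp only [Polynomial.lcoeff_apply, Polynomial.coeff_one_zero, one_smul,
      left_eq_add] at h1
    have h2 := coeff_zero_sum_Iic γ (fun β => ((∏ e, (γ e).choose (β e) : ℕ) : K) *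
        (Polynomial.lcoeff K 0 ∘ₗ Λ) (MvPolynomial.monomial β 1))
    rw [h1] at h2
    simpa using h2.symm
  exact LinearMap.congr_fun key f

open Classical in
theorem IsOneCocycle.derivative_monomial {Λ : MvPolynomial ε K →ₗ[K] K[X]} (h : IsOneCocycle Λ)
    (γ : ε →₀ ℕ) : (Λ (MvPolynomial.monomial γ 1)).derivative =
      ∑ β ∈ Finset.Iic γ, (((∏ e, (γ e).choose (β e) : ℕ) : K) *
        (Λ (MvPolynomial.monomial β 1)).coeff 1) •
          (Polynomial.X ^ (γ.degree - β.degree) : K[X]) := by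
  have h1 := congrArg (sliceRight (Polynomial.lcoeff K 1)) (h (MvPolynomial.monomial γ 1))
  rw [sliceRight_coeff_one_polyComul, map_add, sliceRight_map, sliceRight_tmul,
    sliceRight_polyCoaction] at h1
  simpa [Polynomial.coeff_one] using h1

theorem polyIntegral_monomial (n : ℕ) : polyIntegral (Polynomial.monomial n (1 : K)) =
    Polynomial.monomial (n + 1) (1 / ((n : K) + 1)) := by
  have h := (Polynomial.basisMonomials K).constr_basis K
    (fun n => Polynomial.monomial (n + 1) (1 / ((n : K) + 1))) n
  rwa [Polynomial.coe_basisMonomials] at h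

theorem coeff_zero_polyIntegral (p : K[X]) : (polyIntegral p).coeff 0 = 0 := by
  have key : Polynomial.lcoeff K 0 ∘ₗ polyIntegral = 0 := by
    refine (Polynomial.basisMonomials K).ext fun n => ?_
    simp [polyIntegral_monomial, Polynomial.coeff_monomial]
  exact LinearMap.congr_fun key p

theorem derivative_polyIntegral [CharZero K] (p : K[X]) : (polyIntegral p).derivative = p := by
  have key : Polynomial.derivative ∘ₗ polyIntegral = (LinearMap.id : K[X] →ₗ[K] K[X]) := by
    refine (Polynomial.basisMonomials K).ext fun n => ?_
    have : (n : K) + 1 ≠ 0 := Nat.cast_add_one_ne_zero n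
    simp only [LinearMap.comp_apply, polyIntegral_monomial,
      Polynomial.derivative_monomial, Polynomial.coe_basisMonomials, LinearMap.id_apply]
    simp [this]
  exact LinearMap.congr_fun key p

theorem polyIntegral_derivative [CharZero K] (p : K[X]) :
    polyIntegral p.derivative = p - Polynomial.C (p.coeff 0) := by
  refine Polynomial.ext_of_derivative ?_ ?_
  · rw [derivative_polyIntegral]; simp
  · rw [coeff_zero_polyIntegral]; simp

theorem iterPDeriv_monomial (α γ : ε →₀ ℕ) :
    iterPDeriv α (MvPolynomial.monomial γ (1 : K)) =
      MvPolynomial.monomial (γ - α) ((∏ e, (γ e).descFactorial (α e) : ℕ) : K) := by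
  have h := (MvPolynomial.basisMonomials ε K).constr_basis K (fun γ =>
    MvPolynomial.monomial (γ - α) ((∏ e, (γ e).descFactorial (α e) : ℕ) : K)) γ
  rwa [MvPolynomial.coe_basisMonomials] at h

open Classical in
theorem diffOp_monomial (A : MvPowerSeries ε K) (γ : ε →₀ ℕ) :
    diffOp A (MvPolynomial.monomial γ (1 : K)) =
      ∑ α ∈ Finset.Iic γ, MvPowerSeries.coeff α A • iterPDeriv α (MvPolynomial.monomial γ 1) := by
  have h := (MvPolynomial.basisMonomials ε K).constr_basis K (fun γ =>
    ∑ α ∈ Finset.Iic γ, MvPowerSeries.coeff α A •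
      iterPDeriv α (MvPolynomial.monomial γ (1 : K))) γ
  rwa [MvPolynomial.coe_basisMonomials] at h

open Classical in
theorem diffOp_monomial_of_le (A : MvPowerSeries ε K) {γ γ' : ε →₀ ℕ} (h : γ ≤ γ') :
    diffOp A (MvPolynomial.monomial γ (1 : K)) =
      ∑ α ∈ Finset.Iic γ', MvPowerSeries.coeff α A •
        iterPDeriv α (MvPolynomial.monomial γ 1) := by
  rw [diffOp_monomial]
  refine Finset.sum_subset (Finset.Iic_subset_Iic.2 h) fun α _ hα => ?_
  rw [Finset.mem_Iic, Finsupp.le_def] at hα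
  push Not at hα
  obtain ⟨e, he⟩ := hα
  rw [iterPDeriv_monomial, Finset.prod_eq_zero (Finset.mem_univ e)
    (Nat.descFactorial_eq_zero_iff_lt.2 he)]
  simp

theorem prod_descFactorial_sub_single (γ α : ε →₀ ℕ) (e : ε) :
    γ e * ∏ x, ((γ - Finsupp.single e 1 : ε →₀ ℕ) x).descFactorial (α x) =
      (∏ x, (γ x).descFactorial (α x)) * (γ - α) e := by
  classical
  rw [← Finset.mul_prod_erase _ _ (Finset.mem_univ e),
    ← Finset.mul_prod_erase _ (fun x => (γ x).descFactorial (α x)) (Finset.mem_univ e)]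
  have h1 : ∀ x ∈ Finset.univ.erase e, ((γ - Finsupp.single e 1 : ε →₀ ℕ) x).descFactorial (α x) =
      (γ x).descFactorial (α x) := by
    intro x hx
    rw [Finsupp.tsub_apply, Finsupp.single_eq_of_ne (Finset.ne_of_mem_erase hx), tsub_zero]
  rw [Finset.prod_congr rfl h1, ← mul_assoc, mul_right_comm _ _ ((γ - α) e)]
  congr 1
  simp only [Finsupp.tsub_apply, Finsupp.single_eq_same]
  rw [mul_comm _ (γ e - α e), ← Nat.descFactorial_succ]
  cases γ e with
  | zero => simp
  | succ n => rw [Nat.succ_descFactorial_succ]; rfl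

theorem diffOp_pderiv (A : MvPowerSeries ε K) (e : ε) (f : MvPolynomial ε K) :
    diffOp A (MvPolynomial.pderiv e f) = MvPolynomial.pderiv e (diffOp A f) := by
  have key : diffOp A ∘ₗ (MvPolynomial.pderiv e : Derivation K (MvPolynomial ε K) (MvPolynomial ε K))  =
      ((MvPolynomial.pderiv e : Derivation K (MvPolynomial ε K) (MvPolynomial ε K)) :
        MvPolynomial ε K →ₗ[K] MvPolynomial ε K) ∘ₗ diffOp A := by
    refine (MvPolynomial.basisMonomials ε K).ext fun γ => ?_
    rw [MvPolynomial.coe_basisMonomials]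
    simp only [LinearMap.comp_apply, Derivation.coeFn_coe]
    rw [diffOp_monomial, map_sum, MvPolynomial.pderiv_monomial, one_mul, ← mul_one (γ e : K),
      ← smul_eq_mul, ← MvPolynomial.smul_monomial, map_smul,
      diffOp_monomial_of_le A (tsub_le_self (a := γ)), Finset.smul_sum]
    refine Finset.sum_congr rfl fun α _ => ?_
    rw [smul_comm, Derivation.map_smul, iterPDeriv_monomial, iterPDeriv_monomial,
      MvPolynomial.pderiv_monomial, MvPolynomial.smul_monomial, tsub_right_comm, smul_eq_mul,
      ← Nat.cast_mul, ← Nat.cast_mul, prod_descFactorial_sub_single]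
  exact LinearMap.congr_fun key f

theorem derivative_aeval_X (f : MvPolynomial ε K) :
    (MvPolynomial.aeval (fun _ : ε => (Polynomial.X : K[X])) f).derivative =
      MvPolynomial.aeval (fun _ : ε => (Polynomial.X : K[X]))
        (∑ e, MvPolynomial.pderiv e f) := by
  classical
  induction f using MvPolynomial.induction_on with
  | C a => simp
  | add p q hp hq => simp only [map_add, hp, hq, Finset.sum_add_distrib]
  | mul_X p e hp =>
    simp only [map_mul, MvPolynomial.aeval_X, Polynomial.derivative_mul, hp,
      Derivation.leibniz, MvPolynomial.pderiv_X, Finset.sum_add_distrib, map_add,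
      Polynomial.derivative_X, smul_eq_mul, ← Finset.mul_sum]
    simp [Pi.single_apply]
    ring

theorem derivative_seriesCocycle [CharZero K] (A : MvPowerSeries ε K) (f : MvPolynomial ε K) :
    (seriesCocycle A f).derivative = Polynomial.C ((seriesCocycle A f).coeff 1) +
      seriesCocycle A (∑ e, MvPolynomial.pderiv e f) := by
  have h1 : (seriesCocycle A f).derivative =
      MvPolynomial.aeval (fun _ : ε => (Polynomial.X : K[X])) (diffOp A f) :=
    derivative_polyIntegral _
  have h2 : seriesCocycle A (∑ e, MvPolynomial.pderiv e f) =
      polyIntegral (seriesCocycle A f).derivative.derivative := by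
    rw [h1, derivative_aeval_X]
    simp only [seriesCocycle, LinearMap.comp_apply, map_sum, diffOp_pderiv, AlgHom.toLinearMap_apply]
  rw [h2, polyIntegral_derivative, Polynomial.coeff_derivative]
  simp

open Classical in
theorem derivative_seriesCocycle_monomial [CharZero K] (a : (ε →₀ ℕ) → K) (γ : ε →₀ ℕ) :
    (seriesCocycle (multinomialSeries a) (MvPolynomial.monomial γ 1)).derivative =
      ∑ β ∈ Finset.Iic γ, (((∏ e, (γ e).choose (β e) : ℕ) : K) *
        (a β * (β.degree.factorial : K))) •
          (Polynomial.X ^ (γ.degree - β.degree) : K[X]) := by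
  refine (derivative_polyIntegral _).trans ?_
  rw [LinearMap.comp_apply, diffOp_monomial, map_sum]
  refine Finset.sum_congr rfl fun β hβ => ?_
  have hβ := Finset.mem_Iic.1 hβ
  rw [map_smul, iterPDeriv_monomial, AlgHom.toLinearMap_apply, MvPolynomial.aeval_monomial]
  have h1 : (γ - β).prod (fun _ k => (Polynomial.X : K[X]) ^ k) =
      Polynomial.X ^ (γ.degree - β.degree) := by
    rw [Finsupp.prod, Finset.prod_pow_eq_pow_sum]
    congr 1
    have := congrArg Finsupp.degree (tsub_add_cancel_of_le hβ)
    rw [map_add] at this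
    change (γ - β).degree = _
    omega
  have h2 : (β.multinomial) * ∏ e, (γ e).descFactorial (β e) =
      (∏ e, (γ e).choose (β e)) * β.degree.factorial := by
    have h3 := Nat.multinomial_spec Finset.univ β
    rw [← Finsupp.multinomial_eq_of_support_subset (Finset.subset_univ _),
      ← Finsupp.degree_eq_sum] at h3
    simp only [Nat.descFactorial_eq_factorial_mul_choose, Finset.prod_mul_distrib]
    rw [← h3]; ring
  rw [h1, ← Algebra.smul_def, smul_smul]
  congr 1
  change a β * _ * _ = _
  rw [mul_assoc, ← Nat.cast_mul, h2, Nat.cast_mul]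
  ring

theorem coeff_zero_seriesCocycle (A : MvPowerSeries ε K) (f : MvPolynomial ε K) :
    (seriesCocycle A f).coeff 0 = 0 := coeff_zero_polyIntegral _

theorem coeff_one_seriesCocycle_monomial [CharZero K] (a : (ε →₀ ℕ) → K) (γ : ε →₀ ℕ) :
    (seriesCocycle (multinomialSeries a) (MvPolynomial.monomial γ 1)).coeff 1 =
      a γ * (γ.degree.factorial : K) := by
  have h := Polynomial.coeff_derivative
    (seriesCocycle (multinomialSeries a) (MvPolynomial.monomial γ 1)) 0
  rw [derivative_seriesCocycle_monomial, coeff_zero_sum_Iic] at h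
  simpa using h.symm

theorem IsOneCocycle.existsUnique [CharZero K] {Λ : MvPolynomial ε K →ₗ[K] K[X]}
    (h : IsOneCocycle Λ) :
    ∃! a : (ε →₀ ℕ) → K, Λ = seriesCocycle (multinomialSeries a) := by
  have hne : ∀ n : ℕ, (n.factorial : K) ≠ 0 := fun n => Nat.cast_ne_zero.2 n.factorial_ne_zero
  refine ⟨fun β => (Λ (MvPolynomial.monomial β 1)).coeff 1 / (β.degree.factorial : K), ?_, ?_⟩
  · refine (MvPolynomial.basisMonomials ε K).ext fun γ => ?_
    rw [MvPolynomial.coe_basisMonomials]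
    refine Polynomial.ext_of_derivative ?_ ?_
    · rw [h.derivative_monomial, derivative_seriesCocycle_monomial]
      simp only [div_mul_cancel₀ _ (hne _)]
    · rw [h.coeff_zero, coeff_zero_seriesCocycle]
  · rintro b rfl
    funext β
    simp only [coeff_one_seriesCocycle_monomial]
    rw [mul_div_cancel_right₀ _ (hne _)]

end CocycleLemmas

/-! ### The order structure of forests -/

theorem Derivation.leibniz_prod {R A ι : Type*} [CommSemiring R] [CommSemiring A] [Algebra R A]
    [DecidableEq ι] (D : Derivation R A A) (s : Finset ι) (g : ι → A) :
    D (∏ c ∈ s, g c) = ∑ c ∈ s, D (g c) * ∏ c' ∈ s.erase c, g c' := by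
  induction s using Finset.induction_on with
  | empty => simp
  | insert a s ha ih =>
    rw [Finset.prod_insert ha, D.leibniz, ih, Finset.sum_insert ha, Finset.erase_insert ha,
      add_comm, smul_eq_mul, smul_eq_mul, Finset.mul_sum, mul_comm _ (D (g a))]
    congr 1
    refine Finset.sum_congr rfl fun c hc => ?_
    have hca : a ≠ c := fun h => ha (h ▸ hc)
    rw [Finset.erase_insert_of_ne hca, Finset.prod_insert fun h => ha (Finset.mem_of_mem_erase h)]
    ring

namespace DecForest

variable {I : Type u} {E : I → Type v} (A : DecForest I E)

theorem le_or_le {x y z : A.V} (hy : x ≤ y) (hz : x ≤ z) : y ≤ z ∨ z ≤ y := by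
  induction x using (wellFounded_gt (α := A.V)).induction with
  | _ x ih =>
    rcases hy.eq_or_lt with rfl | hy
    · exact Or.inl hz
    rcases hz.eq_or_lt with rfl | hz
    · exact Or.inr hy.le
    obtain ⟨p, hp, hpy⟩ := exists_covBy_le_of_lt hy
    obtain ⟨q, hq, hqz⟩ := exists_covBy_le_of_lt hz
    obtain rfl := A.forest x p q hp hq
    exact ih p hp.lt hpy hqz

theorem eq_of_covBy_of_le {x c c' v : A.V} (hc : c ⋖ v) (hc' : c' ⋖ v) (h : x ≤ c)
    (h' : x ≤ c') : c = c' := by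
  by_contra hne
  rcases A.le_or_le h h' with h1 | h1
  · exact hc.2 (lt_of_le_of_ne h1 hne) hc'.1
  · exact hc'.2 (lt_of_le_of_ne h1 (Ne.symm hne)) hc.1

/-- The first edge on the path from `v` down to `d` has decoration `e`. -/
def Toward (v d : A.V) (e : E (A.vdec v)) : Prop :=
  ∃ (c : A.V) (h : c ⋖ v), d ≤ c ∧ A.edec c v h = e

variable {A}

theorem Toward.lt {v d : A.V} {e : E (A.vdec v)} (h : A.Toward v d e) : d < v := by
  obtain ⟨c, hc, hd, -⟩ := h
  exact hd.trans_lt hc.lt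

theorem Toward.unique {v d : A.V} {e e' : E (A.vdec v)} (h : A.Toward v d e)
    (h' : A.Toward v d e') : e = e' := by
  obtain ⟨c, hc, hd, rfl⟩ := h
  obtain ⟨c', hc', hd', rfl⟩ := h'
  obtain rfl := A.eq_of_covBy_of_le hc hc' hd hd'
  rfl

theorem exists_toward {v d : A.V} (h : d < v) : ∃ e, A.Toward v d e := by
  obtain ⟨c, hd, hc⟩ := exists_le_covBy_of_lt h
  exact ⟨_, c, hc, hd, rfl⟩

open Classical in
theorem sum_toward {M : Type*} [AddCommMonoid M] [∀ i, Fintype (E i)] (s : Finset A.V) (v : A.V)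
    (g : A.V → M) : ∑ e, ∑ d ∈ s with A.Toward v d e, g d = ∑ d ∈ s with d < v, g d := by
  simp only [Finset.sum_filter]
  rw [Finset.sum_comm]
  refine Finset.sum_congr rfl fun d _ => ?_
  split_ifs with h
  · obtain ⟨e, he⟩ := exists_toward h
    rw [Finset.sum_eq_single e, if_pos he]
    · exact fun e' _ hne => if_neg fun he' => hne (he'.unique he)
    · simp
  · exact Finset.sum_eq_zero fun e _ => if_neg fun he => h he.lt

/-! ### The recursive evaluation of a forest -/

variable {K : Type*} [Field K]

open Classical in
/-- The product over the children `c ∈ S` of `v` of the polynomials `p c`, each in the variable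
given by the edge from `v` to `c`. -/
noncomputable def branchProd (A : DecForest I E) (S : Finset A.V) (p : A.V → K[X]) (v : A.V) :
    MvPolynomial (E (A.vdec v)) K :=
  ∏ c : {c // c ⋖ v ∧ c ∈ S}, Polynomial.aeval (MvPolynomial.X (A.edec c v c.2.1)) (p c)

open Classical in
/-- The polynomial of the part of `S` below `v`: it is obtained by applying `Λ` to the product
of the polynomials of the children. -/
noncomputable def val (Λ : ∀ i, MvPolynomial (E i) K →ₗ[K] K[X]) (A : DecForest I E)
    (S : Finset A.V) (v : A.V) : K[X] :=
  Λ (A.vdec v) (∏ c : {c // c ⋖ v ∧ c ∈ S},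
    Polynomial.aeval (MvPolynomial.X (A.edec c v c.2.1)) (val Λ A S c))
termination_by (wellFounded_lt (α := A.V)).wrap v
decreasing_by exact c.2.1.lt

variable (Λ : ∀ i, MvPolynomial (E i) K →ₗ[K] K[X])

theorem val_eq (S : Finset A.V) (v : A.V) :
    A.val Λ S v = Λ (A.vdec v) (A.branchProd S (A.val Λ S) v) := by
  rw [val, branchProd]

open Classical in
/-- The factor of `branchProd` at `c`. -/
noncomputable def branchFactor (A : DecForest I E) (S : Finset A.V) (p : A.V → K[X]) (v c : A.V) :
    MvPolynomial (E (A.vdec v)) K :=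
  if h : c ⋖ v ∧ c ∈ S then Polynomial.aeval (MvPolynomial.X (A.edec c v h.1)) (p c) else 1

theorem branchFactor_of_covBy {S : Finset A.V} {p : A.V → K[X]} {v c : A.V} (h : c ⋖ v)
    (hc : c ∈ S) : A.branchFactor S p v c =
      Polynomial.aeval (MvPolynomial.X (A.edec c v h)) (p c) :=
  dif_pos ⟨h, hc⟩

theorem branchFactor_of_not_covBy {S : Finset A.V} {p : A.V → K[X]} {v c : A.V} (h : ¬ c ⋖ v) :
    A.branchFactor S p v c = 1 :=
  dif_neg fun h' => h h'.1

theorem branchProd_eq_prod (S : Finset A.V) (p : A.V → K[X]) (v : A.V) :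
    A.branchProd S p v = ∏ c, A.branchFactor S p v c := by
  classical
  rw [branchProd]
  refine Finset.prod_of_injOn Subtype.val Subtype.val_injective.injOn
    (fun _ _ => Finset.mem_coe.2 (Finset.mem_univ _)) (fun c _ hc => ?_) (fun c _ => ?_)
  · rw [branchFactor, dif_neg]
    exact fun h => hc ⟨⟨c, h⟩, Finset.mem_coe.2 (Finset.mem_univ _), rfl⟩
  · rw [branchFactor, dif_pos c.2]

theorem branchProd_congr {S S' : Finset A.V} {p p' : A.V → K[X]} {v : A.V}
    (hS : ∀ x < v, x ∈ S ↔ x ∈ S') (hp : ∀ x < v, x ∈ S → p x = p' x) :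
    A.branchProd S p v = A.branchProd S' p' v := by
  classical
  rw [branchProd_eq_prod, branchProd_eq_prod]
  refine Finset.prod_congr rfl fun c _ => ?_
  by_cases h : c ⋖ v ∧ c ∈ S
  · rw [branchFactor, branchFactor, dif_pos h, dif_pos ⟨h.1, (hS c h.1.lt).1 h.2⟩,
      hp c h.1.lt h.2]
  · rw [branchFactor, branchFactor, dif_neg h, dif_neg]
    exact fun h' => h ⟨h'.1, (hS c h'.1.lt).2 h'.2⟩

theorem val_congr {S S' : Finset A.V} {v : A.V} (hS : ∀ x < v, x ∈ S ↔ x ∈ S') :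
    A.val Λ S v = A.val Λ S' v := by
  induction v using (wellFounded_lt (α := A.V)).induction with
  | _ v ih =>
    rw [val_eq, val_eq, branchProd_congr hS]
    exact fun x hx _ => ih x hx fun y hy => hS y (hy.trans hx)

open Classical in
theorem pderiv_branchFactor {S : Finset A.V} (hS : (S : Set A.V).OrdConnected)
    {v c : A.V} (hv : v ∈ S) (e : E (A.vdec v))
    (ih : c ∈ S → c < v → (A.val Λ S c).derivative = Polynomial.C ((A.val Λ S c).coeff 1) +
      ∑ d ∈ S with d < c, (A.val Λ S d).coeff 1 • A.val Λ (S.filter (¬ · ≤ d)) c) :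
    MvPolynomial.pderiv e (A.branchFactor S (A.val Λ S) v c) =
      ∑ d ∈ S with (d ≤ c ∧ ∃ h : c ⋖ v, A.edec c v h = e), (A.val Λ S d).coeff 1 •
        A.branchFactor (S.filter (¬ · ≤ d)) (A.val Λ (S.filter (¬ · ≤ d))) v c := by
  by_cases hc : c ⋖ v ∧ c ∈ S
  · rw [branchFactor, dif_pos hc, Derivation.map_aeval, MvPolynomial.pderiv_X]
    by_cases he : A.edec c v hc.1 = e
    · subst he
      rw [Pi.single_eq_same, smul_eq_mul, mul_one, ih hc.2 hc.1.lt, map_add, Polynomial.aeval_C,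
        map_sum]
      have h1 : (S.filter fun d => d ≤ c ∧ ∃ h : c ⋖ v, A.edec c v h = A.edec c v hc.1) =
          insert c (S.filter fun d => d < c) := by
        ext d
        simp only [Finset.mem_filter, Finset.mem_insert, le_iff_eq_or_lt]
        constructor
        · rintro ⟨hd, h | h, -⟩
          · exact Or.inl h
          · exact Or.inr ⟨hd, h⟩
        · rintro (rfl | ⟨hd, h⟩)
          · exact ⟨hc.2, Or.inl rfl, hc.1, trivial⟩
          · exact ⟨hd, Or.inr h, hc.1, trivial⟩
      rw [h1, Finset.sum_insert (by simp)]
      congr 1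
      · rw [branchFactor, dif_neg (by simp), Algebra.smul_def, mul_one]
      · refine Finset.sum_congr rfl fun d hd => ?_
        have hd := (Finset.mem_filter.1 hd).2
        rw [map_smul, branchFactor, dif_pos ⟨hc.1, Finset.mem_filter.2 ⟨hc.2, not_le_of_gt hd⟩⟩]
    · rw [Pi.single_eq_of_ne he, smul_zero, Finset.filter_false_of_mem, Finset.sum_empty]
      rintro d - ⟨-, h, h'⟩
      exact he h'
  · rw [branchFactor, dif_neg hc, Derivation.map_one_eq_zero, Finset.filter_false_of_mem,
      Finset.sum_empty]
    rintro d hd ⟨hdc, h, -⟩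
    exact hc ⟨h, hS.out hd hv ⟨hdc, h.le⟩⟩

theorem branchFactor_eq_of_not_le (S : Finset A.V) {v c d : A.V}
    (h : c ⋖ v → ¬ d ≤ c) [DecidablePred (fun x => ¬ x ≤ d)]
    (hc : c ⋖ v → ¬ c ≤ d) :
    A.branchFactor (S.filter (¬ · ≤ d)) (A.val Λ (S.filter (¬ · ≤ d))) v c =
      A.branchFactor S (A.val Λ S) v c := by
  by_cases hcv : c ⋖ v
  · rw [branchFactor, branchFactor]
    have h2 : A.val Λ (S.filter (¬ · ≤ d)) c = A.val Λ S c := by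
      refine val_congr Λ fun x hx => ?_
      rw [Finset.mem_filter, and_iff_left]
      intro hxd
      rcases A.le_or_le hx.le hxd with h2 | h2
      · exact hc hcv h2
      · exact h hcv h2
    by_cases hcS : c ∈ S
    · rw [dif_pos ⟨hcv, Finset.mem_filter.2 ⟨hcS, hc hcv⟩⟩, dif_pos ⟨hcv, hcS⟩, h2]
    · rw [dif_neg fun h' => hcS (Finset.mem_filter.1 h'.2).1, dif_neg fun h' => hcS h'.2]
  · rw [branchFactor, branchFactor, dif_neg (fun h => hcv h.1), dif_neg (fun h => hcv h.1)]

open Classical in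
theorem pderiv_branchProd {S : Finset A.V} (hS : (S : Set A.V).OrdConnected)
    {v : A.V} (hv : v ∈ S) (e : E (A.vdec v))
    (ih : ∀ c ∈ S, c < v → (A.val Λ S c).derivative = Polynomial.C ((A.val Λ S c).coeff 1) +
      ∑ d ∈ S with d < c, (A.val Λ S d).coeff 1 • A.val Λ (S.filter (¬ · ≤ d)) c) :
    MvPolynomial.pderiv e (A.branchProd S (A.val Λ S) v) =
      ∑ d ∈ S with A.Toward v d e, (A.val Λ S d).coeff 1 •
        A.branchProd (S.filter (¬ · ≤ d)) (A.val Λ (S.filter (¬ · ≤ d))) v := by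
  rw [branchProd_eq_prod, Derivation.leibniz_prod]
  have h1 : ∀ c : A.V, MvPolynomial.pderiv e (A.branchFactor S (A.val Λ S) v c) *
      ∏ c' ∈ Finset.univ.erase c, A.branchFactor S (A.val Λ S) v c' =
      ∑ d ∈ S with (d ≤ c ∧ ∃ h : c ⋖ v, A.edec c v h = e), (A.val Λ S d).coeff 1 •
        A.branchProd (S.filter (¬ · ≤ d)) (A.val Λ (S.filter (¬ · ≤ d))) v := by
    intro c
    rw [pderiv_branchFactor Λ hS hv e (ih c), Finset.sum_mul]
    refine Finset.sum_congr rfl fun d hd => ?_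
    obtain ⟨hdS, hdc, hcv, -⟩ := Finset.mem_filter.1 hd
    rw [branchProd_eq_prod, smul_mul_assoc, ← Finset.mul_prod_erase _ _ (Finset.mem_univ c)]
    congr 2
    refine Finset.prod_congr rfl fun c' hc' => ?_
    have hne := Finset.ne_of_mem_erase hc'
    refine (branchFactor_eq_of_not_le Λ S (fun h h' => hne ?_) (fun h h' => hne ?_)).symm
    · exact A.eq_of_covBy_of_le h hcv h' hdc
    · exact A.eq_of_covBy_of_le h hcv le_rfl (h'.trans hdc)
  rw [Finset.sum_congr rfl fun c _ => h1 c]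
  simp only [Finset.sum_filter]
  rw [Finset.sum_comm]
  refine Finset.sum_congr rfl fun d _ => ?_
  split_ifs with h
  · obtain ⟨c, hc, hdc, he⟩ := h
    rw [Finset.sum_eq_single c, if_pos ⟨hdc, hc, he⟩]
    · rintro c' - hne
      exact if_neg fun h => hne (A.eq_of_covBy_of_le h.2.1 hc h.1 hdc)
    · simp
  · exact Finset.sum_eq_zero fun c _ => if_neg fun h' => h ⟨c, h'.2.1, h'.1, h'.2.2⟩

theorem ordConnected_filter_not_le {S : Finset A.V} (hS : (S : Set A.V).OrdConnected) (d : A.V)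
    [DecidablePred (fun x => ¬ x ≤ d)] :
    ((S.filter (¬ · ≤ d) : Finset A.V) : Set A.V).OrdConnected := by
  refine ⟨fun x hx y hy z hz => ?_⟩
  simp only [Finset.coe_filter, Set.mem_ofPred_eq] at hx hy ⊢
  exact ⟨hS.out hx.1 hy.1 hz, fun h => hx.2 (hz.1.trans h)⟩

theorem ordConnected_filter_le {S : Finset A.V} (hS : (S : Set A.V).OrdConnected) (d : A.V)
    [DecidablePred (fun x => x ≤ d)] :
    ((S.filter (· ≤ d) : Finset A.V) : Set A.V).OrdConnected := by
  refine ⟨fun x hx y hy z hz => ?_⟩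
  simp only [Finset.coe_filter, Set.mem_ofPred_eq] at hx hy ⊢
  exact ⟨hS.out hx.1 hy.1 hz, hz.2.trans hy.2⟩

open Classical in
theorem derivative_val [∀ i, Fintype (E i)]
    (hΛ : ∀ i f, (Λ i f).derivative = Polynomial.C ((Λ i f).coeff 1) +
      Λ i (∑ e, MvPolynomial.pderiv e f))
    {S : Finset A.V} (hS : (S : Set A.V).OrdConnected) {v : A.V} (hv : v ∈ S) :
    (A.val Λ S v).derivative = Polynomial.C ((A.val Λ S v).coeff 1) +
      ∑ d ∈ S with d < v, (A.val Λ S d).coeff 1 • A.val Λ (S.filter (¬ · ≤ d)) v := by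
  induction v using (wellFounded_lt (α := A.V)).induction with
  | _ v ih =>
    rw [val_eq, hΛ]
    congr 1
    rw [Finset.sum_congr rfl fun e _ =>
      pderiv_branchProd Λ hS hv e fun c hc hcv => ih c hcv hc, sum_toward, map_sum]
    simp only [map_smul, val_eq Λ _ v]

end DecForest

/-! ### Binary tubings of a subset of a forest -/

namespace DecForest

variable {I : Type u} {E : I → Type v} {A : DecForest I E}

theorem isTube_of_isGreatest {X : Finset A.V} {v : A.V} (hX : (X : Set A.V).OrdConnected)
    (hv : IsGreatest (X : Set A.V) v) : IsTube X := by
  refine ⟨hX, ?_⟩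
  rw [SimpleGraph.connected_iff]
  refine ⟨?_, ⟨⟨v, hv.1⟩⟩⟩
  have h : ∀ x : (X : Set A.V), ((SimpleGraph.fromRel fun x y : A.V => x ≤ y).induce
      (X : Set A.V)).Reachable x ⟨v, hv.1⟩ := by
    intro x
    by_cases hx : x = ⟨v, hv.1⟩
    · rw [hx]
    · refine SimpleGraph.Adj.reachable ?_
      rw [SimpleGraph.induce_adj, SimpleGraph.fromRel_adj]
      exact ⟨fun h => hx (Subtype.ext h), Or.inl (hv.2 x.2)⟩
  exact fun x y => (h x).trans (h y).symm

theorem exists_isGreatest_of_isTube {X : Finset A.V} (hX : IsTube X) :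
    ∃ v, IsGreatest (X : Set A.V) v := by
  obtain ⟨-, hc⟩ := hX
  obtain ⟨⟨x, hx⟩⟩ := hc.nonempty
  obtain ⟨m, hm⟩ := X.exists_maximal ⟨x, hx⟩
  refine ⟨m, hm.1, fun y hy => ?_⟩
  obtain ⟨p⟩ := hc.preconnected ⟨m, hm.1⟩ ⟨y, hy⟩
  have key : ∀ (a b : (X : Set A.V)), ((SimpleGraph.fromRel fun x y : A.V => x ≤ y).induce
      (X : Set A.V)).Walk a b → (a : A.V) ≤ m → (b : A.V) ≤ m := by
    intro a b p
    induction p with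
    | nil => exact id
    | @cons a b c hab _ ih =>
      intro ha
      refine ih ?_
      rw [SimpleGraph.induce_adj, SimpleGraph.fromRel_adj] at hab
      rcases hab.2 with h | h
      · rcases A.le_or_le h ha with h' | h'
        · exact h'
        · exact hm.2 b.2 h'
      · exact h.trans ha
  exact key _ _ p le_rfl

theorem _root_.IsTube.nonempty {X : Finset A.V} (hX : IsTube X) : X.Nonempty := by
  obtain ⟨⟨x, hx⟩⟩ := hX.2.nonempty
  exact ⟨x, hx⟩

theorem lt_of_tubeArrow {X Y : Finset A.V} {x y : A.V} (hX : IsTube X)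
    (hx : IsGreatest (X : Set A.V) x) (hy : IsGreatest (Y : Set A.V) y) (h : TubeArrow X Y) :
    x < y := by
  obtain ⟨hd, a, ha, b, hb, hab⟩ := h
  rw [Finset.disjoint_right] at hd
  rcases A.le_or_le (hx.2 ha) hab.le with h1 | h1
  · refine (lt_of_le_of_ne h1 ?_).trans_le (hy.2 hb)
    rintro rfl
    exact hd hb hx.1
  · exact absurd (hX.1.out ha hx.1 ⟨hab.le, h1⟩) (hd hb)

theorem isTubing_iff {τ : Finset (Finset A.V)} : IsTubing τ ↔
    (∀ X ∈ τ, IsTube X) ∧ ∀ X ∈ τ, ∀ Y ∈ τ, Disjoint X Y ∨ X ⊆ Y ∨ Y ⊆ X := by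
  refine ⟨fun h => ⟨h.tube, h.laminar⟩, fun ⟨h1, h2⟩ => ⟨h1, h2, fun X hX hXX => ?_⟩⟩
  have key : ∀ Y, Relation.TransGen (fun Y Z => Y ∈ τ ∧ Z ∈ τ ∧ TubeArrow Y Z) X Y →
      Y ∈ τ ∧ ∀ x y, IsGreatest (X : Set A.V) x → IsGreatest (Y : Set A.V) y → x < y := by
    intro Y hY
    induction hY with
    | single h => exact ⟨h.2.1, fun x y hx hy => lt_of_tubeArrow (h1 _ hX) hx hy h.2.2⟩
    | tail _ h ih =>
      refine ⟨h.2.1, fun x y hx hy => ?_⟩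
      obtain ⟨z, hz⟩ := exists_isGreatest_of_isTube (h1 _ h.1)
      exact (ih.2 x z hx hz).trans (lt_of_tubeArrow (h1 _ h.1) hz hy h.2.2)
  obtain ⟨x, hx⟩ := exists_isGreatest_of_isTube (h1 _ hX)
  exact lt_irrefl _ ((key X hXX).2 x x hx hx)

/-- A tubing of `A` all of whose tubes are contained in `S`. -/
def IsTubingOn (S : Finset A.V) (τ : Finset (Finset A.V)) : Prop :=
  IsTubing τ ∧ ∀ Z ∈ τ, Z ⊆ S

open Classical in
/-- The maximal tubings of `S`. -/
noncomputable def binTub (S : Finset A.V) : Finset (Finset (Finset A.V)) :=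
  Finset.univ.filter fun τ => Maximal (IsTubingOn S) τ

theorem mem_binTub {S : Finset A.V} {τ : Finset (Finset A.V)} :
    τ ∈ binTub S ↔ Maximal (IsTubingOn S) τ := by
  simp [binTub]

theorem Tub_eq_binTub : Tub A.V = binTub (Finset.univ : Finset A.V) := by
  classical
  ext τ
  rw [mem_binTub, Tub, Finset.mem_filter, and_iff_right (Finset.mem_univ _)]
  have : IsTubingOn (Finset.univ : Finset A.V) = IsTubing := by
    funext τ
    simp [IsTubingOn]
  rw [this]

open Classical in
theorem IsTubingOn.insert {S Z : Finset A.V} {τ : Finset (Finset A.V)} (h : IsTubingOn S τ)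
    (hZ : IsTube Z) (hZS : Z ⊆ S) (hl : ∀ W ∈ τ, Disjoint Z W ∨ Z ⊆ W ∨ W ⊆ Z) :
    IsTubingOn S (insert Z τ) := by
  obtain ⟨h1, h2⟩ := h
  rw [isTubing_iff] at h1
  refine ⟨isTubing_iff.2 ⟨?_, ?_⟩, ?_⟩
  · simp only [Finset.mem_insert, forall_eq_or_imp]
    exact ⟨hZ, h1.1⟩
  · simp only [Finset.mem_insert, forall_eq_or_imp]
    refine ⟨⟨Or.inr (Or.inl subset_rfl), hl⟩, fun W hW => ⟨?_, h1.2 W hW⟩⟩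
    rcases hl W hW with h | h | h
    · exact Or.inl h.symm
    · exact Or.inr (Or.inr h)
    · exact Or.inr (Or.inl h)
  · simp only [Finset.mem_insert, forall_eq_or_imp]
    exact ⟨hZS, h2⟩

theorem mem_of_mem_binTub {S Z : Finset A.V} {τ : Finset (Finset A.V)} (h : τ ∈ binTub S)
    (hZ : IsTube Z) (hZS : Z ⊆ S) (hl : ∀ W ∈ τ, Disjoint Z W ∨ Z ⊆ W ∨ W ⊆ Z) : Z ∈ τ := by
  classical
  rw [mem_binTub] at h
  exact h.2 (h.1.insert hZ hZS hl) (Finset.subset_insert _ _) (Finset.mem_insert_self _ _)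

theorem self_mem_of_mem_binTub {S : Finset A.V} (hS : IsTube S) {τ : Finset (Finset A.V)}
    (h : τ ∈ binTub S) : S ∈ τ :=
  mem_of_mem_binTub h hS subset_rfl fun W hW => Or.inr (Or.inr ((mem_binTub.1 h).1.2 W hW))

theorem subset_of_mem_binTub {S Z : Finset A.V} {τ : Finset (Finset A.V)} (h : τ ∈ binTub S)
    (hZ : Z ∈ τ) : Z ⊆ S := (mem_binTub.1 h).1.2 Z hZ

theorem isTube_of_mem_binTub {S Z : Finset A.V} {τ : Finset (Finset A.V)} (h : τ ∈ binTub S)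
    (hZ : Z ∈ τ) : IsTube Z := (mem_binTub.1 h).1.1.tube Z hZ

theorem IsTubingOn.filter_subset {S X : Finset A.V} {τ : Finset (Finset A.V)}
    (h : IsTubingOn S τ) [DecidablePred (fun Z => Z ⊆ X)] :
    IsTubingOn X (τ.filter (· ⊆ X)) := by
  have h1 := isTubing_iff.1 h.1
  refine ⟨isTubing_iff.2 ⟨fun Z hZ => h1.1 Z (Finset.mem_filter.1 hZ).1, fun Z hZ W hW =>
    h1.2 Z (Finset.mem_filter.1 hZ).1 W (Finset.mem_filter.1 hW).1⟩,
    fun Z hZ => (Finset.mem_filter.1 hZ).2⟩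

theorem binTub_singleton (v : A.V) : binTub ({v} : Finset A.V) = {{{v}}} := by
  have hS : IsTube ({v} : Finset A.V) :=
    isTube_of_isGreatest (v := v) (by simp [Set.ordConnected_singleton]) (by simp)
  have h1 : ∀ τ, IsTubingOn ({v} : Finset A.V) τ → τ ⊆ {{v}} := by
    intro τ h Z hZ
    rcases Finset.subset_singleton_iff.1 (h.2 Z hZ) with h' | h'
    · exact absurd h' (h.1.tube Z hZ).nonempty.ne_empty
    · exact Finset.mem_singleton.2 h'
  have h2 : IsTubingOn ({v} : Finset A.V) {{v}} :=
    ⟨isTubing_iff.2 ⟨by simpa using hS, by simp⟩, by simp⟩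
  ext τ
  rw [mem_binTub, Finset.mem_singleton]
  constructor
  · intro h
    exact le_antisymm (h1 τ h.1) (h.2 h2 (h1 τ h.1))
  · rintro rfl
    exact ⟨h2, fun ρ hρ _ => h1 ρ hρ⟩

section Split
open Classical

variable {S : Finset A.V} {v d : A.V}

theorem disjoint_filter_le : Disjoint (S.filter (¬ · ≤ d)) (S.filter (· ≤ d)) := by
  rw [Finset.disjoint_left]
  intro x hx hx'
  exact (Finset.mem_filter.1 hx).2 (Finset.mem_filter.1 hx').2

theorem filter_not_le_union : S.filter (¬ · ≤ d) ∪ S.filter (· ≤ d) = S := by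
  rw [Finset.union_comm, Finset.filter_union_filter_not_eq]

theorem isGreatest_filter_le (hd : d ∈ S) :
    IsGreatest ((S.filter (· ≤ d) : Finset A.V) : Set A.V) d :=
  ⟨by simp [hd], fun x hx => (Finset.mem_filter.1 hx).2⟩

theorem isGreatest_filter_not_le (hv : IsGreatest (S : Set A.V) v) (hd : d < v) :
    IsGreatest ((S.filter (¬ · ≤ d) : Finset A.V) : Set A.V) v :=
  ⟨Finset.mem_coe.2 (Finset.mem_filter.2 ⟨hv.1, not_le_of_gt hd⟩),
    fun _ hx => hv.2 (Finset.mem_filter.1 hx).1⟩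

/-- A tube that does not contain an edge lies on one side of it. -/
theorem subset_filter_or_subset_filter {Z : Finset A.V} (hZ : IsTube Z) (hZS : Z ⊆ S) {p : A.V}
    (hp : d ⋖ p) (h : d ∈ Z → p ∉ Z) :
    Z ⊆ S.filter (¬ · ≤ d) ∨ Z ⊆ S.filter (· ≤ d) := by
  obtain ⟨m, hm⟩ := exists_isGreatest_of_isTube hZ
  by_cases hmd : m ≤ d
  · exact Or.inr fun x hx => Finset.mem_filter.2 ⟨hZS hx, (hm.2 hx).trans hmd⟩
  · refine Or.inl fun x hx => Finset.mem_filter.2 ⟨hZS hx, fun hxd => ?_⟩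
    have hdm : d < m := by
      rcases A.le_or_le (hm.2 hx) hxd with h1 | h1
      · exact absurd h1 hmd
      · exact lt_of_le_not_ge h1 hmd
    have hpm : p ≤ m := by
      obtain ⟨q, hq, hqm⟩ := exists_covBy_le_of_lt hdm
      rwa [A.forest d p q hp hq]
    exact h (hZ.1.out hx hm.1 ⟨hxd, hdm.le⟩) (hZ.1.out hx hm.1 ⟨hxd.trans hp.le, hpm⟩)

/-- In a tubing of a tube with at least two elements, some edge is not contained in any proper
tube. -/
theorem exists_edge (hS : (S : Set A.V).OrdConnected) (hv : IsGreatest (S : Set A.V) v)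
    (hne : S ≠ {v}) {τ : Finset (Finset A.V)} (hτ : IsTubingOn S τ) :
    ∃ d p : A.V, d ∈ S ∧ d < v ∧ d ⋖ p ∧ ∀ Z ∈ τ, Z ≠ S → d ∈ Z → p ∉ Z := by
  by_contra! hcon
  have hl := (isTubing_iff.1 hτ.1).2
  obtain ⟨x, hx, hxv⟩ : ∃ x ∈ S, x ≠ v := by
    by_contra! h
    exact hne (Finset.eq_singleton_iff_unique_mem.2 ⟨hv.1, h⟩)
  obtain ⟨c, hxc, hcv⟩ := exists_le_covBy_of_lt (lt_of_le_of_ne (hv.2 hx) hxv)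
  have hc : c ∈ S := hS.out hx hv.1 ⟨hxc, hcv.le⟩
  obtain ⟨Z₀, hZ₀, hZ₀S, -, hvZ₀⟩ := hcon c v hc hcv.lt hcv
  obtain ⟨M, hM⟩ := (τ.filter fun Z => Z ≠ S ∧ v ∈ Z).exists_maximal
    ⟨Z₀, Finset.mem_filter.2 ⟨hZ₀, hZ₀S, hvZ₀⟩⟩
  obtain ⟨hMτ, hMS, hvM⟩ := Finset.mem_filter.1 hM.1
  have key : ∀ y ∈ S, y ∈ M := by
    intro y
    induction y using (wellFounded_gt (α := A.V)).induction with
    | _ y ih =>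
      intro hy
      rcases (hv.2 hy).eq_or_lt with rfl | hyv
      · exact hvM
      obtain ⟨p, hyp, hpv⟩ := exists_covBy_le_of_lt hyv
      have hpM := ih p hyp.lt (hS.out hy hv.1 ⟨hyp.le, hpv⟩)
      obtain ⟨Z, hZ, hZS, hyZ, hpZ⟩ := hcon y p hy hyv hyp
      rcases hl M hMτ Z hZ with h | h | h
      · exact absurd hpZ (Finset.disjoint_left.1 h hpM)
      · exact hM.2 (Finset.mem_filter.2 ⟨hZ, hZS, h hvM⟩) h hyZ
      · exact h hyZ
  exact hMS (le_antisymm (hτ.2 M hMτ) key)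

theorem isTubingOn_insert_union {τ' τ'' : Finset (Finset A.V)} (hS : IsTube S)
    (h' : IsTubingOn (S.filter (¬ · ≤ d)) τ') (h'' : IsTubingOn (S.filter (· ≤ d)) τ'') :
    IsTubingOn S (insert S (τ' ∪ τ'')) := by
  have hsub : ∀ Z ∈ τ' ∪ τ'', Z ⊆ S := by
    intro Z hZ
    rcases Finset.mem_union.1 hZ with h | h
    · exact (h'.2 Z h).trans (Finset.filter_subset _ _)
    · exact (h''.2 Z h).trans (Finset.filter_subset _ _)
  have hdis : ∀ Z ∈ τ', ∀ W ∈ τ'', Disjoint Z W := fun Z hZ W hW =>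
    Finset.disjoint_of_subset_left (h'.2 Z hZ)
      (Finset.disjoint_of_subset_right (h''.2 W hW) disjoint_filter_le)
  refine IsTubingOn.insert ⟨isTubing_iff.2 ⟨fun Z hZ => ?_, fun Z hZ W hW => ?_⟩, hsub⟩ hS
    subset_rfl fun W hW => Or.inr (Or.inr (hsub W hW))
  · rcases Finset.mem_union.1 hZ with h | h
    · exact h'.1.tube Z h
    · exact h''.1.tube Z h
  · rcases Finset.mem_union.1 hZ with h | h <;> rcases Finset.mem_union.1 hW with h1 | h1
    · exact h'.1.laminar Z h W h1
    · exact Or.inl (hdis Z h W h1)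
    · exact Or.inl (hdis W h1 Z h).symm
    · exact h''.1.laminar Z h W h1

theorem isTube_filter_not_le (hS : (S : Set A.V).OrdConnected) (hv : IsGreatest (S : Set A.V) v)
    (hd : d < v) : IsTube (S.filter (¬ · ≤ d)) :=
  isTube_of_isGreatest (ordConnected_filter_not_le hS d) (isGreatest_filter_not_le hv hd)

theorem isTube_filter_le (hS : (S : Set A.V).OrdConnected) (hd : d ∈ S) :
    IsTube (S.filter (· ≤ d)) :=
  isTube_of_isGreatest (ordConnected_filter_le hS d) (isGreatest_filter_le hd)

theorem filter_insert_union_left {τ' τ'' : Finset (Finset A.V)} (hd : d ∈ S)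
    (h' : IsTubingOn (S.filter (¬ · ≤ d)) τ') (h'' : IsTubingOn (S.filter (· ≤ d)) τ'') :
    (insert S (τ' ∪ τ'')).filter (· ⊆ S.filter (¬ · ≤ d)) = τ' := by
  ext Z
  rw [Finset.mem_filter, Finset.mem_insert, Finset.mem_union]
  constructor
  · rintro ⟨rfl | h | h, hZ⟩
    · exact absurd le_rfl (Finset.mem_filter.1 (hZ hd)).2
    · exact h
    · obtain ⟨x, hx⟩ := (h''.1.tube Z h).nonempty
      exact absurd (h''.2 Z h hx) (Finset.disjoint_left.1 disjoint_filter_le (hZ hx))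
  · exact fun h => ⟨Or.inr (Or.inl h), h'.2 Z h⟩

theorem filter_insert_union_right {τ' τ'' : Finset (Finset A.V)} (hv : v ∈ S) (hd : d < v)
    (h' : IsTubingOn (S.filter (¬ · ≤ d)) τ') (h'' : IsTubingOn (S.filter (· ≤ d)) τ'') :
    (insert S (τ' ∪ τ'')).filter (· ⊆ S.filter (· ≤ d)) = τ'' := by
  ext Z
  rw [Finset.mem_filter, Finset.mem_insert, Finset.mem_union]
  constructor
  · rintro ⟨rfl | h | h, hZ⟩
    · exact absurd (Finset.mem_filter.1 (hZ hv)).2 (not_le_of_gt hd)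
    · obtain ⟨x, hx⟩ := (h'.1.tube Z h).nonempty
      exact absurd (hZ hx) (Finset.disjoint_left.1 disjoint_filter_le (h'.2 Z h hx))
    · exact h
  · exact fun h => ⟨Or.inr (Or.inr h), h''.2 Z h⟩

theorem insert_union_mem_binTub (hS : (S : Set A.V).OrdConnected)
    (hv : IsGreatest (S : Set A.V) v) (hd : d ∈ S) (hdv : d < v) {τ' τ'' : Finset (Finset A.V)}
    (h' : τ' ∈ binTub (S.filter (¬ · ≤ d))) (h'' : τ'' ∈ binTub (S.filter (· ≤ d))) :
    insert S (τ' ∪ τ'') ∈ binTub S := by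
  have hX := self_mem_of_mem_binTub (isTube_filter_not_le hS hv hdv) h'
  have hY := self_mem_of_mem_binTub (isTube_filter_le hS hd) h''
  rw [mem_binTub] at h' h'' ⊢
  refine ⟨isTubingOn_insert_union (isTube_of_isGreatest hS hv) h'.1 h''.1, fun ρ hρ hle Z hZ => ?_⟩
  have hle' : insert S (τ' ∪ τ'') ⊆ ρ := hle
  have h1 : ρ.filter (· ⊆ S.filter (¬ · ≤ d)) ⊆ τ' := by
    refine h'.2 hρ.filter_subset fun W hW => Finset.mem_filter.2 ⟨hle' ?_, h'.1.2 W hW⟩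
    exact Finset.mem_insert_of_mem (Finset.mem_union_left _ hW)
  have h2 : ρ.filter (· ⊆ S.filter (· ≤ d)) ⊆ τ'' := by
    refine h''.2 hρ.filter_subset fun W hW => Finset.mem_filter.2 ⟨hle' ?_, h''.1.2 W hW⟩
    exact Finset.mem_insert_of_mem (Finset.mem_union_right _ hW)
  have hXρ : S.filter (¬ · ≤ d) ∈ ρ :=
    hle' (Finset.mem_insert_of_mem (Finset.mem_union_left _ hX))
  have hYρ : S.filter (· ≤ d) ∈ ρ :=
    hle' (Finset.mem_insert_of_mem (Finset.mem_union_right _ hY))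
  have hZS := hρ.2 Z hZ
  have hcX : Z ⊆ S.filter (¬ · ≤ d) → Z ∈ insert S (τ' ∪ τ'') := fun h =>
    Finset.mem_insert_of_mem (Finset.mem_union_left _ (h1 (Finset.mem_filter.2 ⟨hZ, h⟩)))
  have hcY : Z ⊆ S.filter (· ≤ d) → Z ∈ insert S (τ' ∪ τ'') := fun h =>
    Finset.mem_insert_of_mem (Finset.mem_union_right _ (h2 (Finset.mem_filter.2 ⟨hZ, h⟩)))
  rcases hρ.1.laminar _ hXρ Z hZ with h | h | h
  · exact hcY fun x hx => Finset.mem_filter.2 ⟨hZS hx, by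
      by_contra hxd
      exact Finset.disjoint_left.1 h (Finset.mem_filter.2 ⟨hZS hx, hxd⟩) hx⟩
  · rcases hρ.1.laminar _ hYρ Z hZ with h3 | h3 | h3
    · exact hcX fun x hx => Finset.mem_filter.2 ⟨hZS hx, fun hxd =>
        Finset.disjoint_left.1 h3 (Finset.mem_filter.2 ⟨hZS hx, hxd⟩) hx⟩
    · have : Z = S := by
        refine le_antisymm hZS ?_
        rw [← filter_not_le_union (S := S) (d := d)]
        exact Finset.union_subset h h3
      rw [this]
      exact Finset.mem_insert_self _ _
    · exact hcY h3
  · exact hcX h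

theorem exists_of_mem_binTub (hS : (S : Set A.V).OrdConnected)
    (hv : IsGreatest (S : Set A.V) v) (hne : S ≠ {v}) {τ : Finset (Finset A.V)}
    (hτ : τ ∈ binTub S) : ∃ d ∈ S, d < v ∧ ∃ τ' ∈ binTub (S.filter (¬ · ≤ d)),
      ∃ τ'' ∈ binTub (S.filter (· ≤ d)), τ = insert S (τ' ∪ τ'') := by
  have hST := isTube_of_isGreatest hS hv
  have hSτ := self_mem_of_mem_binTub hST hτ
  have hτon := (mem_binTub.1 hτ).1
  obtain ⟨d, p, hd, hdv, hdp, hcut⟩ := exists_edge hS hv hne hτon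
  have hside : ∀ Z ∈ τ, Z ≠ S → Z ⊆ S.filter (¬ · ≤ d) ∨ Z ⊆ S.filter (· ≤ d) :=
    fun Z hZ hZS => subset_filter_or_subset_filter (hτon.1.tube Z hZ) (hτon.2 Z hZ) hdp
      (hcut Z hZ hZS)
  have hXτ : S.filter (¬ · ≤ d) ∈ τ := by
    refine mem_of_mem_binTub hτ (isTube_filter_not_le hS hv hdv) (Finset.filter_subset _ _)
      fun W hW => ?_
    by_cases hWS : W = S
    · exact Or.inr (Or.inl (hWS ▸ Finset.filter_subset _ _))
    · rcases hside W hW hWS with h | h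
      · exact Or.inr (Or.inr h)
      · exact Or.inl (Finset.disjoint_of_subset_right h disjoint_filter_le)
  have hYτ : S.filter (· ≤ d) ∈ τ := by
    refine mem_of_mem_binTub hτ (isTube_filter_le hS hd) (Finset.filter_subset _ _)
      fun W hW => ?_
    by_cases hWS : W = S
    · exact Or.inr (Or.inl (hWS ▸ Finset.filter_subset _ _))
    · rcases hside W hW hWS with h | h
      · exact Or.inl (Finset.disjoint_of_subset_right h disjoint_filter_le.symm)
      · exact Or.inr (Or.inr h)
  have hmax : ∀ X ∈ τ, τ.filter (· ⊆ X) ∈ binTub X := by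
    intro X hX
    refine mem_binTub.2 ⟨hτon.filter_subset, fun ρ hρ hle Z hZ => Finset.mem_filter.2 ⟨?_, hρ.2 Z hZ⟩⟩
    refine mem_of_mem_binTub hτ (hρ.1.tube Z hZ) ((hρ.2 Z hZ).trans (hτon.2 X hX)) fun W hW => ?_
    rcases hτon.1.laminar W hW X hX with h | h | h
    · exact Or.inl (Finset.disjoint_of_subset_left (hρ.2 Z hZ) h.symm)
    · exact hρ.1.laminar Z hZ W (hle (Finset.mem_filter.2 ⟨hW, h⟩))
    · exact Or.inr (Or.inl ((hρ.2 Z hZ).trans h))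
  refine ⟨d, hd, hdv, _, hmax _ hXτ, _, hmax _ hYτ, ?_⟩
  ext Z
  rw [Finset.mem_insert, Finset.mem_union, Finset.mem_filter, Finset.mem_filter]
  constructor
  · intro hZ
    by_cases hZS : Z = S
    · exact Or.inl hZS
    · exact Or.inr ((hside Z hZ hZS).imp (fun h => ⟨hZ, h⟩) fun h => ⟨hZ, h⟩)
  · rintro (rfl | h | h)
    · exact hSτ
    · exact h.1
    · exact h.1

theorem le_of_insert_union_eq (hS : (S : Set A.V).OrdConnected)
    (hv : IsGreatest (S : Set A.V) v) {e : A.V} (hd : d ∈ S) (hdv : d < v)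
    (he : e ∈ S) (hev : e < v) {τ' τ'' ρ' ρ'' : Finset (Finset A.V)}
    (h' : τ' ∈ binTub (S.filter (¬ · ≤ d)))
    (h1' : ρ' ∈ binTub (S.filter (¬ · ≤ e))) (h1'' : ρ'' ∈ binTub (S.filter (· ≤ e)))
    (h : insert S (τ' ∪ τ'') = insert S (ρ' ∪ ρ'')) : e ≤ d := by
  have hX := self_mem_of_mem_binTub (isTube_filter_not_le hS hv hdv) h'
  have hX1 : S.filter (¬ · ≤ d) ∈ insert S (ρ' ∪ ρ'') :=
    h ▸ Finset.mem_insert_of_mem (Finset.mem_union_left _ hX)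
  have hvX : v ∈ S.filter (¬ · ≤ d) := Finset.mem_filter.2 ⟨hv.1, not_le_of_gt hdv⟩
  by_contra hed
  have heX : e ∈ S.filter (¬ · ≤ d) := Finset.mem_filter.2 ⟨he, hed⟩
  rcases Finset.mem_insert.1 hX1 with h2 | h2
  · rw [← h2] at hd
    exact (Finset.mem_filter.1 hd).2 le_rfl
  rcases Finset.mem_union.1 h2 with h2 | h2
  · exact (Finset.mem_filter.1 (subset_of_mem_binTub h1' h2 heX)).2 le_rfl
  · exact not_le_of_gt hev (Finset.mem_filter.1 (subset_of_mem_binTub h1'' h2 hvX)).2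

/-- A binary tubing with at least two vertices is given by an edge and binary tubings of the two
pieces obtained by cutting it. -/
theorem sum_binTub {M : Type*} [AddCommMonoid M] (hS : (S : Set A.V).OrdConnected)
    (hv : IsGreatest (S : Set A.V) v) (hne : S ≠ {v}) (g : Finset (Finset A.V) → M) :
    ∑ τ ∈ binTub S, g τ = ∑ d ∈ S with d < v, ∑ τ' ∈ binTub (S.filter (¬ · ≤ d)),
      ∑ τ'' ∈ binTub (S.filter (· ≤ d)), g (insert S (τ' ∪ τ'')) := by
  simp only [← Finset.sum_product']
  rw [Finset.sum_sigma']
  symm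
  refine Finset.sum_bij (fun p _ => insert S (p.2.1 ∪ p.2.2)) ?_ ?_ ?_ fun _ _ => rfl
  · rintro ⟨d, τ', τ''⟩ hp
    simp only [Finset.mem_sigma, Finset.mem_filter, Finset.mem_product] at hp
    exact insert_union_mem_binTub hS hv hp.1.1 hp.1.2 hp.2.1 hp.2.2
  · rintro ⟨d, τ', τ''⟩ hp ⟨e, ρ', ρ''⟩ hq h
    simp only [Finset.mem_sigma, Finset.mem_filter, Finset.mem_product] at hp hq h
    obtain rfl : d = e := le_antisymm
      (le_of_insert_union_eq hS hv hq.1.1 hq.1.2 hp.1.1 hp.1.2 hq.2.1 hp.2.1 hp.2.2 h.symm)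
      (le_of_insert_union_eq hS hv hp.1.1 hp.1.2 hq.1.1 hq.1.2 hp.2.1 hq.2.1 hq.2.2 h)
    have h1 := (mem_binTub.1 hp.2.1).1
    have h2 := (mem_binTub.1 hp.2.2).1
    have h3 := (mem_binTub.1 hq.2.1).1
    have h4 := (mem_binTub.1 hq.2.2).1
    have h5 : τ' = ρ' := by
      rw [← filter_insert_union_left hp.1.1 h1 h2, h, filter_insert_union_left hp.1.1 h3 h4]
    have h6 : τ'' = ρ'' := by
      rw [← filter_insert_union_right hv.1 hp.1.2 h1 h2, h,
        filter_insert_union_right hv.1 hp.1.2 h3 h4]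
    rw [h5, h6]
  · intro τ hτ
    obtain ⟨d, hd, hdv, τ', h', τ'', h'', rfl⟩ := exists_of_mem_binTub hS hv hne hτ
    exact ⟨⟨d, τ', τ''⟩, by simp [hd, hdv, h', h''], rfl⟩

end Split

end DecForest

/-! ### Statistics of a tubing obtained from tubings of two pieces -/

section Split
open Classical

variable {P : Type*}

/-- `τ` consists of the tube `S = X ⊔ Y` and of tubings `τ'` of `X` and `τ''` of `Y`. -/
structure IsSplit (S X Y : Finset P) (τ τ' τ'' : Finset (Finset P)) : Prop where
  left_mem : X ∈ τ'
  right_mem : Y ∈ τ''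
  left_sub : ∀ Z ∈ τ', Z ⊆ X
  right_sub : ∀ Z ∈ τ'', Z ⊆ Y
  left_nonempty : ∀ Z ∈ τ', Z.Nonempty
  right_nonempty : ∀ Z ∈ τ'', Z.Nonempty
  disj : Disjoint X Y
  union_eq : X ∪ Y = S
  mem_iff : ∀ Z, Z ∈ τ ↔ Z = S ∨ Z ∈ τ' ∨ Z ∈ τ''

namespace IsSplit

variable {S X Y Z Q : Finset P} {τ τ' τ'' : Finset (Finset P)}

theorem symm (h : IsSplit S X Y τ τ' τ'') : IsSplit S Y X τ τ'' τ' :=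
  ⟨h.right_mem, h.left_mem, h.right_sub, h.left_sub, h.right_nonempty, h.left_nonempty,
    h.disj.symm, by rw [Finset.union_comm, h.union_eq], fun Z => by rw [h.mem_iff, or_comm (a := Z ∈ τ')]⟩

theorem left_subset (h : IsSplit S X Y τ τ' τ'') : X ⊆ S :=
  h.union_eq ▸ Finset.subset_union_left

theorem false_of_subset (h : IsSplit S X Y τ τ' τ'') (hne : Z.Nonempty) (hX : Z ⊆ X)
    (hY : Z ⊆ Y) : False := by
  obtain ⟨x, hx⟩ := hne
  exact Finset.disjoint_left.1 h.disj (hX hx) (hY hx)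

theorem not_subset_left (h : IsSplit S X Y τ τ' τ'') : ¬ S ⊆ X := fun hS =>
  h.false_of_subset (h.right_nonempty Y h.right_mem) (h.symm.left_subset.trans hS) subset_rfl

theorem subset_of_mem (h : IsSplit S X Y τ τ' τ'') (hZ : Z ∈ τ) : Z ⊆ S := by
  rcases (h.mem_iff Z).1 hZ with rfl | hZ | hZ
  · exact subset_rfl
  · exact (h.left_sub Z hZ).trans h.left_subset
  · exact (h.right_sub Z hZ).trans h.symm.left_subset

theorem mem_of_mem_left (h : IsSplit S X Y τ τ' τ'') (hZ : Z ∈ τ') : Z ∈ τ :=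
  (h.mem_iff Z).2 (Or.inr (Or.inl hZ))

theorem mem_left_of_subset (h : IsSplit S X Y τ τ' τ'') (hZ : Z ∈ τ) {W : Finset P} (hW : W ∈ τ')
    (hWZ : W ⊆ Z) (hZS : Z ≠ S) : Z ∈ τ' := by
  rcases (h.mem_iff Z).1 hZ with hZ | hZ | hZ
  · exact absurd hZ hZS
  · exact hZ
  · exact (h.false_of_subset (h.left_nonempty W hW) (h.left_sub W hW)
      (hWZ.trans (h.right_sub Z hZ))).elim

theorem isParentTube_left (h : IsSplit S X Y τ τ' τ'') (hZ : Z ∈ τ') (hZX : Z ≠ X) :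
    IsParentTube τ Z Q ↔ IsParentTube τ' Z Q := by
  constructor
  · rintro ⟨hQ, hZQ, hmin⟩
    have hQX := hmin X (h.mem_of_mem_left h.left_mem) ((h.left_sub Z hZ).ssubset_of_ne hZX)
    refine ⟨h.mem_left_of_subset hQ hZ hZQ.1 ?_, hZQ,
      fun W hW => hmin W (h.mem_of_mem_left hW)⟩
    rintro rfl
    exact h.not_subset_left hQX
  · rintro ⟨hQ, hZQ, hmin⟩
    refine ⟨h.mem_of_mem_left hQ, hZQ, fun W hW hZW => ?_⟩
    by_cases hWS : W = S
    · exact hWS ▸ (h.left_sub Q hQ).trans h.left_subset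
    · exact hmin W (h.mem_left_of_subset hW hZ hZW.1 hWS) hZW

theorem isParentTube_piece (h : IsSplit S X Y τ τ' τ'') : IsParentTube τ X Q ↔ Q = S := by
  have key : ∀ W ∈ τ, X ⊂ W → W = S := by
    intro W hW hXW
    by_contra hne
    exact hXW.2 (h.left_sub W (h.mem_left_of_subset hW h.left_mem hXW.1 hne))
  constructor
  · rintro ⟨hQ, hXQ, -⟩
    exact key Q hQ hXQ
  · rintro rfl
    refine ⟨(h.mem_iff _).2 (Or.inl rfl), ⟨h.left_subset, h.not_subset_left⟩, fun W hW hXW => ?_⟩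
    rw [key W hW hXW]

theorem not_isParentTube_whole (h : IsSplit S X Y τ τ' τ'') : ¬ IsParentTube τ S Q :=
  fun hQ => hQ.2.1.2 (h.subset_of_mem hQ.1)

theorem not_isParentTube_left_piece (h : IsSplit S X Y τ τ' τ'') : ¬ IsParentTube τ' X Q :=
  fun hQ => hQ.2.1.2 (h.left_sub Q hQ.1)

variable [PartialOrder P]

theorem isUpperTube_left (h : IsSplit S X Y τ τ' τ'') (hZ : Z ∈ τ') (hZX : Z ≠ X) :
    IsUpperTube τ Z ↔ IsUpperTube τ' Z := by
  simp only [IsUpperTube, h.isParentTube_left hZ hZX, hZ, h.mem_of_mem_left hZ]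

theorem isLowerTube_left [Fintype P] (h : IsSplit S X Y τ τ' τ'') (hZ : Z ∈ τ') (hZX : Z ≠ X) :
    IsLowerTube τ Z ↔ IsLowerTube τ' Z := by
  simp only [IsLowerTube, h.isParentTube_left hZ hZX, hZ, h.mem_of_mem_left hZ]

theorem not_isUpperTube_left_piece (h : IsSplit S X Y τ τ' τ'') : ¬ IsUpperTube τ' X :=
  fun ⟨_, _, hQ, _⟩ => h.not_isParentTube_left_piece hQ

theorem not_isUpperTube_whole (h : IsSplit S X Y τ τ' τ'') : ¬ IsUpperTube τ S :=
  fun ⟨_, _, hQ, _⟩ => h.not_isParentTube_whole hQ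

theorem isUpperTube_piece (h : IsSplit S X Y τ τ' τ'')
    (hup : ∀ x ∈ X, ∀ y ∈ S, x ≤ y → y ∈ X) : IsUpperTube τ X :=
  ⟨h.mem_of_mem_left h.left_mem, S, h.isParentTube_piece.2 rfl, hup⟩

theorem isLowerTube_piece [Fintype P] (h : IsSplit S X Y τ τ' τ'')
    (hup : ∀ x ∈ X, ∀ y ∈ S, x ≤ y → y ∈ X) : IsLowerTube τ Y := by
  refine ⟨h.symm.mem_of_mem_left h.right_mem, Or.inr ⟨S, h.symm.isParentTube_piece.2 rfl, ?_⟩⟩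
  intro x hx y hy hyx
  rw [← h.union_eq, Finset.mem_union] at hy
  refine hy.resolve_left fun hyX => ?_
  exact Finset.disjoint_left.1 h.disj (hup y hyX x (h.symm.left_subset hx) hyx) hx

theorem not_isUpperTube_piece (h : IsSplit S X Y τ τ' τ'')
    (hlow : ∃ y ∈ Y, ∃ x ∈ X, y ≤ x) : ¬ IsUpperTube τ Y := by
  rintro ⟨-, Q, hQ, hup⟩
  obtain rfl := h.symm.isParentTube_piece.1 hQ
  obtain ⟨y, hy, x, hx, hyx⟩ := hlow
  exact Finset.disjoint_left.1 h.disj hx (hup y hy x (h.left_subset hx) hyx)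

theorem isUpperTube_iff (h : IsSplit S X Y τ τ' τ'')
    (hup : ∀ x ∈ X, ∀ y ∈ S, x ≤ y → y ∈ X) (hlow : ∃ y ∈ Y, ∃ x ∈ X, y ≤ x) :
    IsUpperTube τ Z ↔ IsUpperTube τ' Z ∨ IsUpperTube τ'' Z ∨ Z = X := by
  constructor
  · intro hZ
    rcases (h.mem_iff Z).1 hZ.1 with rfl | hZ1 | hZ1
    · exact (h.not_isUpperTube_whole hZ).elim
    · by_cases hZX : Z = X
      · exact Or.inr (Or.inr hZX)
      · exact Or.inl ((h.isUpperTube_left hZ1 hZX).1 hZ)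
    · by_cases hZY : Z = Y
      · subst hZY
        exact (h.not_isUpperTube_piece hlow hZ).elim
      · exact Or.inr (Or.inl ((h.symm.isUpperTube_left hZ1 hZY).1 hZ))
  · rintro (hZ | hZ | rfl)
    · refine (h.isUpperTube_left hZ.1 ?_).2 hZ
      rintro rfl
      exact h.not_isUpperTube_left_piece hZ
    · refine (h.symm.isUpperTube_left hZ.1 ?_).2 hZ
      rintro rfl
      exact h.symm.not_isUpperTube_left_piece hZ
    · exact h.isUpperTube_piece hup

end IsSplit

end Split

namespace DecTree
open Classical

variable {I : Type u} {E : I → Type v} {t : DecTree I E} {S X Y Z : Finset t.V}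
  {τ τ' τ'' : Finset (Finset t.V)} {v d : t.V}

theorem isUpperOfType_left (h : IsSplit S X Y τ τ' τ'') (hZ : Z ∈ τ') (hZX : Z ≠ X)
    (e : E (t.vdec v)) : t.IsUpperOfType τ Z v e ↔ t.IsUpperOfType τ' Z v e := by
  have hZX' := h.left_sub Z hZ
  have hZn := h.left_nonempty Z hZ
  rw [IsUpperOfType, IsUpperOfType, h.isUpperTube_left hZ hZX]
  refine and_congr_right fun _ => and_congr_right fun _ => exists_congr fun W => ?_
  constructor
  · rintro ⟨hW, hd, hu, hr⟩
    have hWn : W.Nonempty := by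
      obtain ⟨w, -, -, hw, -⟩ := hr
      exact ⟨w, hw.1⟩
    have hW' : W ∈ τ' := by
      rcases (h.mem_iff W).1 hW.1 with rfl | hW1 | hW1
      · obtain ⟨x, hx⟩ := hZn
        exact absurd (h.left_subset (hZX' hx)) (Finset.disjoint_left.1 hd hx)
      · exact hW1
      · have hWY := h.right_sub W hW1
        rcases (h.mem_iff _).1 hu with hu | hu | hu
        · refine (hZX (le_antisymm hZX' fun x hx => ?_)).elim
          have hxS := h.left_subset hx
          rw [← hu, Finset.mem_union] at hxS
          exact hxS.resolve_right fun hxW => Finset.disjoint_left.1 h.disj hx (hWY hxW)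
        · exact (h.false_of_subset hWn (Finset.subset_union_right.trans (h.left_sub _ hu))
            hWY).elim
        · exact (h.false_of_subset hZn hZX'
            (Finset.subset_union_left.trans (h.right_sub _ hu))).elim
    have hWX := h.left_sub W hW'
    have hWne : W ≠ X := by
      rintro rfl
      obtain ⟨x, hx⟩ := hZn
      exact Finset.disjoint_left.1 hd hx (hZX' hx)
    refine ⟨(h.isLowerTube_left hW' hWne).1 hW, hd, ?_, hr⟩
    refine h.mem_left_of_subset hu hZ Finset.subset_union_left fun hS => ?_
    exact h.not_subset_left (hS ▸ Finset.union_subset hZX' hWX)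
  · rintro ⟨hW, hd, hu, hr⟩
    refine ⟨(h.isLowerTube_left hW.1 ?_).2 hW, hd, h.mem_of_mem_left hu, hr⟩
    rintro rfl
    obtain ⟨x, hx⟩ := hZn
    exact Finset.disjoint_left.1 hd hx (hZX' hx)

theorem isUpperOfType_piece (h : IsSplit S X Y τ τ' τ'')
    (hup : ∀ x ∈ X, ∀ y ∈ S, x ≤ y → y ∈ X) (hd : IsGreatest (Y : Set t.V) d)
    (e : E (t.vdec v)) :
    t.IsUpperOfType τ X v e ↔ IsGreatest (X : Set t.V) v ∧ t.Toward v d e := by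
  rw [IsUpperOfType, and_iff_right (h.isUpperTube_piece hup)]
  refine and_congr_right fun _ => ?_
  constructor
  · rintro ⟨W, hW, hXW, hu, w, c, hc, hw, hwc, he⟩
    have hWY : W = Y := by
      have hXn := h.left_nonempty X h.left_mem
      have hS : X ∪ W = S := by
        by_contra hne
        have h1 := h.mem_left_of_subset hu h.left_mem Finset.subset_union_left hne
        exact Finset.disjoint_left.1 hXW (h.left_sub _ h1 (Finset.mem_union_right _ hw.1)) hw.1
      rw [← h.union_eq] at hS
      ext x
      have h1 := Finset.ext_iff.1 hS x
      have h2 : x ∈ X → x ∉ W := fun hx => Finset.disjoint_left.1 hXW hx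
      have h3 : x ∈ X → x ∉ Y := fun hx => Finset.disjoint_left.1 h.disj hx
      rw [Finset.mem_union, Finset.mem_union] at h1
      tauto
    subst hWY
    obtain rfl := hw.unique hd
    exact ⟨c, hc, hwc, he⟩
  · rintro ⟨c, hc, hdc, he⟩
    refine ⟨Y, h.isLowerTube_piece hup, h.disj, ?_, d, c, hc, hd, hdc, he⟩
    rw [h.union_eq, h.mem_iff]
    exact Or.inl rfl

theorem isUpperOfType_iff (h : IsSplit S X Y τ τ' τ'')
    (hup : ∀ x ∈ X, ∀ y ∈ S, x ≤ y → y ∈ X) (hlow : ∃ y ∈ Y, ∃ x ∈ X, y ≤ x)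
    (hd : IsGreatest (Y : Set t.V) d) (e : E (t.vdec v)) :
    t.IsUpperOfType τ Z v e ↔ t.IsUpperOfType τ' Z v e ∨ t.IsUpperOfType τ'' Z v e ∨
      (Z = X ∧ IsGreatest (X : Set t.V) v ∧ t.Toward v d e) := by
  constructor
  · intro hZ
    rcases (h.mem_iff Z).1 hZ.1.1 with rfl | hZ1 | hZ1
    · exact (h.not_isUpperTube_whole hZ.1).elim
    · by_cases hZX : Z = X
      · subst hZX
        exact Or.inr (Or.inr ⟨rfl, (isUpperOfType_piece h hup hd e).1 hZ⟩)
      · exact Or.inl ((isUpperOfType_left h hZ1 hZX e).1 hZ)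
    · by_cases hZY : Z = Y
      · subst hZY
        exact (h.not_isUpperTube_piece hlow hZ.1).elim
      · exact Or.inr (Or.inl ((isUpperOfType_left h.symm hZ1 hZY e).1 hZ))
  · rintro (hZ | hZ | ⟨rfl, hZ⟩)
    · refine (isUpperOfType_left h hZ.1.1 ?_ e).2 hZ
      rintro rfl
      exact h.not_isUpperTube_left_piece hZ.1
    · refine (isUpperOfType_left h.symm hZ.1.1 ?_ e).2 hZ
      rintro rfl
      exact h.symm.not_isUpperTube_left_piece hZ.1
    · exact (isUpperOfType_piece h hup hd e).2 hZ

theorem b_split (h : IsSplit S X Y τ τ' τ'') (hX : t.root ∈ X) : t.b τ = t.b τ' + 1 := by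
  have h1 : (τ.filter fun Z => t.root ∈ Z) = insert S (τ'.filter fun Z => t.root ∈ Z) := by
    ext Z
    rw [Finset.mem_filter, Finset.mem_insert, Finset.mem_filter, h.mem_iff]
    constructor
    · rintro ⟨hZ | hZ | hZ, hr⟩
      · exact Or.inl hZ
      · exact Or.inr ⟨hZ, hr⟩
      · exact absurd (h.right_sub Z hZ hr) (Finset.disjoint_left.1 h.disj hX)
    · rintro (hZ | ⟨hZ, hr⟩)
      · exact ⟨Or.inl hZ, hZ ▸ h.left_subset hX⟩
      · exact ⟨Or.inr (Or.inl hZ), hr⟩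
  rw [b, b, h1, Finset.card_insert_of_notMem]
  exact fun hS => h.not_subset_left (h.left_sub S (Finset.mem_filter.1 hS).1)

variable [∀ i, Fintype (E i)]

theorem rk_apply (τ : Finset (Finset t.V)) (v : t.V) (e : E (t.vdec v)) :
    t.rk τ v e = (Finset.univ.filter fun X => t.IsUpperOfType τ X v e).card := by
  change (τ.filter fun X => t.IsUpperOfType τ X v e).card = _
  congr 1
  ext X
  simp only [Finset.mem_filter, Finset.mem_univ, true_and, and_iff_right_iff_imp]
  exact fun h => h.1.1

theorem betaVec_apply (τ : Finset (Finset t.V)) (k : ℕ) (e : E (t.vdec t.root)) :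
    t.betaVec τ k e = (Finset.univ.filter fun X => t.IsUpperOfType τ X t.root e ∧
      k - 1 ≤ (Finset.univ.filter fun Z => IsUpperTube τ Z ∧ t.root ∈ Z ∧ X ⊂ Z).card).card := by
  change (τ.filter fun X => t.IsUpperOfType τ X t.root e ∧
    k - 1 ≤ (τ.filter fun Z => IsUpperTube τ Z ∧ t.root ∈ Z ∧ X ⊂ Z).card).card = _
  have h1 : ∀ X, (τ.filter fun Z => IsUpperTube τ Z ∧ t.root ∈ Z ∧ X ⊂ Z) =
      Finset.univ.filter fun Z => IsUpperTube τ Z ∧ t.root ∈ Z ∧ X ⊂ Z := by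
    intro X
    ext Z
    simp only [Finset.mem_filter, Finset.mem_univ, true_and, and_iff_right_iff_imp]
    exact fun h => h.1.1
  simp only [h1]
  congr 1
  ext X
  simp only [Finset.mem_filter, Finset.mem_univ, true_and, and_iff_right_iff_imp]
  exact fun h => h.1.1.1

theorem betaVec_one (τ : Finset (Finset t.V)) : t.betaVec τ 1 = t.rk τ t.root := by
  ext e
  simp [betaVec_apply, rk_apply]

theorem rk_right (h : IsSplit S X Y τ τ' τ'')
    (hup : ∀ x ∈ X, ∀ y ∈ S, x ≤ y → y ∈ X) (hlow : ∃ y ∈ Y, ∃ x ∈ X, y ≤ x)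
    (hd : IsGreatest (Y : Set t.V) d) (hv : v ∈ Y) : t.rk τ v = t.rk τ'' v := by
  ext e
  rw [rk_apply, rk_apply]
  congr 1
  ext Z
  simp only [Finset.mem_filter, Finset.mem_univ, true_and]
  rw [isUpperOfType_iff h hup hlow hd]
  constructor
  · rintro (hZ | hZ | ⟨-, hZ, -⟩)
    · exact absurd hv (Finset.disjoint_left.1 h.disj (h.left_sub Z hZ.1.1 hZ.2.1.1))
    · exact hZ
    · exact absurd hv (Finset.disjoint_left.1 h.disj hZ.1)
  · exact fun hZ => Or.inr (Or.inl hZ)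

theorem rk_left (h : IsSplit S X Y τ τ' τ'')
    (hup : ∀ x ∈ X, ∀ y ∈ S, x ≤ y → y ∈ X) (hlow : ∃ y ∈ Y, ∃ x ∈ X, y ≤ x)
    (hd : IsGreatest (Y : Set t.V) d) (hv : v ∈ X) (hvX : ¬ IsGreatest (X : Set t.V) v) :
    t.rk τ v = t.rk τ' v := by
  ext e
  rw [rk_apply, rk_apply]
  congr 1
  ext Z
  simp only [Finset.mem_filter, Finset.mem_univ, true_and]
  rw [isUpperOfType_iff h hup hlow hd]
  constructor
  · rintro (hZ | hZ | ⟨-, hZ, -⟩)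
    · exact hZ
    · exact absurd (h.right_sub Z hZ.1.1 hZ.2.1.1) (Finset.disjoint_left.1 h.disj hv)
    · exact absurd hZ hvX
  · exact fun hZ => Or.inl hZ

theorem rk_greatest (h : IsSplit S X Y τ τ' τ'')
    (hup : ∀ x ∈ X, ∀ y ∈ S, x ≤ y → y ∈ X) (hlow : ∃ y ∈ Y, ∃ x ∈ X, y ≤ x)
    (hd : IsGreatest (Y : Set t.V) d) (hv : IsGreatest (X : Set t.V) v) {e : E (t.vdec v)}
    (he : t.Toward v d e) : t.rk τ v = t.rk τ' v + Finsupp.single e 1 := by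
  ext e'
  have hiff : ∀ Z, t.IsUpperOfType τ Z v e' ↔
      t.IsUpperOfType τ' Z v e' ∨ (Z = X ∧ t.Toward v d e') := by
    intro Z
    rw [isUpperOfType_iff h hup hlow hd]
    constructor
    · rintro (hZ | hZ | ⟨hZ, -, hZ'⟩)
      · exact Or.inl hZ
      · exact absurd (h.right_sub Z hZ.1.1 hZ.2.1.1) (Finset.disjoint_left.1 h.disj hv.1)
      · exact Or.inr ⟨hZ, hZ'⟩
    · rintro (hZ | hZ)
      · exact Or.inl hZ
      · exact Or.inr (Or.inr ⟨hZ.1, hv, hZ.2⟩)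
  rw [Finsupp.add_apply, rk_apply, rk_apply]
  by_cases hee : e = e'
  · subst hee
    have h1 : (Finset.univ.filter fun Z => t.IsUpperOfType τ Z v e) =
        insert X (Finset.univ.filter fun Z => t.IsUpperOfType τ' Z v e) := by
      ext Z
      simp only [Finset.mem_filter, Finset.mem_univ, true_and, Finset.mem_insert, hiff]
      tauto
    rw [h1, Finset.card_insert_of_notMem, Finsupp.single_eq_same]
    intro hX
    exact h.not_isUpperTube_left_piece (Finset.mem_filter.1 hX).2.1
  · rw [Finsupp.single_eq_of_ne (Ne.symm hee), add_zero]
    congr 1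
    ext Z
    simp only [Finset.mem_filter, Finset.mem_univ, true_and, hiff]
    refine or_iff_left fun hZ => hee (he.unique hZ.2)

theorem betaVec_split (h : IsSplit S X Y τ τ' τ'')
    (hup : ∀ x ∈ X, ∀ y ∈ S, x ≤ y → y ∈ X) (hlow : ∃ y ∈ Y, ∃ x ∈ X, y ≤ x)
    (hd : IsGreatest (Y : Set t.V) d) (hX : t.root ∈ X) (k : ℕ) :
    t.betaVec τ (k + 2) = t.betaVec τ' (k + 1) := by
  have hYr : ∀ Z ∈ τ'', t.root ∉ Z := fun Z hZ hr =>
    Finset.disjoint_left.1 h.disj hX (h.right_sub Z hZ hr)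
  have hcount : ∀ W : Finset t.V, W ∈ τ' → W ≠ X →
      (Finset.univ.filter fun Z => IsUpperTube τ Z ∧ t.root ∈ Z ∧ W ⊂ Z).card =
      (Finset.univ.filter fun Z => IsUpperTube τ' Z ∧ t.root ∈ Z ∧ W ⊂ Z).card + 1 := by
    intro W hW hWX
    rw [← Finset.card_insert_of_notMem (a := X)]
    · congr 1
      ext Z
      simp only [Finset.mem_filter, Finset.mem_univ, true_and, Finset.mem_insert,
        h.isUpperTube_iff hup hlow]
      constructor
      · rintro ⟨hZ | hZ | hZ, hr⟩
        · exact Or.inr ⟨hZ, hr⟩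
        · exact absurd hr.1 (hYr Z hZ.1)
        · exact Or.inl hZ
      · rintro (rfl | ⟨hZ, hr⟩)
        · exact ⟨Or.inr (Or.inr rfl), hX, (h.left_sub W hW).ssubset_of_ne hWX⟩
        · exact ⟨Or.inl hZ, hr⟩
    · intro hX'
      exact h.not_isUpperTube_left_piece (Finset.mem_filter.1 hX').2.1
  have hcountX : (Finset.univ.filter fun Z => IsUpperTube τ Z ∧ t.root ∈ Z ∧ X ⊂ Z).card = 0 := by
    rw [Finset.card_eq_zero, Finset.filter_eq_empty_iff]
    rintro Z - ⟨hZ, hr, hXZ⟩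
    rcases (h.isUpperTube_iff hup hlow).1 hZ with hZ | hZ | hZ
    · exact hXZ.2 (h.left_sub Z hZ.1)
    · exact hYr Z hZ.1 hr
    · exact hXZ.ne hZ.symm
  ext e
  rw [betaVec_apply, betaVec_apply]
  congr 1
  ext W
  simp only [Finset.mem_filter, Finset.mem_univ, true_and]
  constructor
  · rintro ⟨hW, hk⟩
    rcases (isUpperOfType_iff h hup hlow hd e).1 hW with hW | hW | ⟨rfl, -⟩
    · refine ⟨hW, ?_⟩
      rw [hcount W hW.1.1] at hk
      · omega
      · rintro rfl
        exact h.not_isUpperTube_left_piece hW.1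
    · exact absurd hW.2.1.1 (hYr W hW.1.1)
    · rw [hcountX] at hk
      omega
  · rintro ⟨hW, hk⟩
    refine ⟨(isUpperOfType_iff h hup hlow hd e).2 (Or.inl hW), ?_⟩
    rw [hcount W hW.1.1]
    · omega
    · rintro rfl
      exact h.not_isUpperTube_left_piece hW.1

end DecTree

/-! ### The tubing expansion -/

theorem sum_Icc_one_eq_sum_range {M : Type*} [AddCommMonoid M] (f : ℕ → M) (n : ℕ) :
    ∑ k ∈ Finset.Icc 1 n, f k = ∑ k ∈ Finset.range n, f (k + 1) := by
  induction n with
  | zero => simp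
  | succ n ih => rw [Finset.sum_Icc_succ_top (by omega), ih, Finset.sum_range_succ]

section FactorialScale

variable {K : Type*} [Field K] {ε : Type*}

/-- The map `L ^ α ↦ |α|! L ^ α`. -/
noncomputable def factorialScale : MvPolynomial ε K →ₗ[K] MvPolynomial ε K :=
  (MvPolynomial.basisMonomials ε K).constr K fun α =>
    MvPolynomial.monomial α (α.degree.factorial : K)

theorem factorialScale_monomial (α : ε →₀ ℕ) (c : K) :
    factorialScale (MvPolynomial.monomial α c) =
      MvPolynomial.monomial α (c * (α.degree.factorial : K)) := by
  have h := (MvPolynomial.basisMonomials ε K).constr_basis K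
    (fun α => MvPolynomial.monomial α (α.degree.factorial : K)) α
  rw [MvPolynomial.coe_basisMonomials] at h
  conv_lhs => rw [← mul_one c, ← smul_eq_mul, ← MvPolynomial.smul_monomial]
  rw [map_smul, factorialScale, h, MvPolynomial.smul_monomial, smul_eq_mul]

/-- The linear form `L ^ α ↦ a α`. -/
noncomputable def monomialForm (a : (ε →₀ ℕ) → K) : MvPolynomial ε K →ₗ[K] K :=
  (MvPolynomial.basisMonomials ε K).constr K a

theorem monomialForm_monomial (a : (ε →₀ ℕ) → K) (α : ε →₀ ℕ) (c : K) :
    monomialForm a (MvPolynomial.monomial α c) = c * a α := by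
  have h := (MvPolynomial.basisMonomials ε K).constr_basis K a α
  rw [MvPolynomial.coe_basisMonomials] at h
  rw [← mul_one c, ← smul_eq_mul, ← MvPolynomial.smul_monomial, map_smul, monomialForm, h]
  simp

variable [Fintype ε]

theorem coeff_one_seriesCocycle [CharZero K] (a : (ε →₀ ℕ) → K) (f : MvPolynomial ε K) :
    (seriesCocycle (multinomialSeries a) f).coeff 1 = monomialForm a (factorialScale f) := by
  have key : Polynomial.lcoeff K 1 ∘ₗ seriesCocycle (multinomialSeries a) =
      monomialForm a ∘ₗ factorialScale := by
    refine (MvPolynomial.basisMonomials ε K).ext fun γ => ?_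
    rw [MvPolynomial.coe_basisMonomials, LinearMap.comp_apply, LinearMap.comp_apply,
      Polynomial.lcoeff_apply, coeff_one_seriesCocycle_monomial, factorialScale_monomial,
      monomialForm_monomial, one_mul, mul_comm]
  exact LinearMap.congr_fun key f

theorem factorialScale_eq (f : MvPolynomial ε K) : factorialScale f = MvPolynomial.C (MvPolynomial.constantCoeff f) +
    ∑ e, MvPolynomial.X e * factorialScale (MvPolynomial.pderiv e f) := by
  induction f using MvPolynomial.induction_on' with
  | add p q hp hq =>
    rw [map_add, hp, hq]
    simp only [map_add, mul_add, Finset.sum_add_distrib]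
    ring
  | monomial α c =>
    have h1 : ∀ e, MvPolynomial.X e * factorialScale (MvPolynomial.pderiv e (MvPolynomial.monomial α c)) =
        MvPolynomial.monomial α (c * ((α e * (α.degree - 1).factorial : ℕ) : K)) := by
      intro e
      rw [MvPolynomial.pderiv_monomial]
      rcases Nat.eq_zero_or_pos (α e) with h | h
      · simp [h]
      · have hle : Finsupp.single e 1 ≤ α := by
          rw [Finsupp.single_le_iff]
          exact h
        have hdeg : (α - Finsupp.single e 1).degree = α.degree - 1 := by
          have := congrArg Finsupp.degree (tsub_add_cancel_of_le hle)
          rw [map_add, Finsupp.degree_single] at this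
          omega
        rw [factorialScale_monomial, hdeg, MvPolynomial.X, MvPolynomial.monomial_mul,
          add_tsub_cancel_of_le hle, one_mul, mul_assoc, Nat.cast_mul]
    rw [Finset.sum_congr rfl fun e _ => h1 e, ← map_sum, ← Finset.mul_sum, ← Nat.cast_sum,
      ← Finset.sum_mul, ← Finsupp.degree_eq_sum, factorialScale_monomial]
    rcases Nat.eq_zero_or_pos α.degree with h | h
    · rw [Finsupp.degree_eq_zero_iff] at h
      subst h
      simp
    · have hα : α ≠ 0 := by
        rintro rfl
        simp at h
      classical
      rw [Nat.mul_factorial_pred h.ne', MvPolynomial.constantCoeff_monomial, if_neg hα,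
        map_zero, zero_add]

end FactorialScale

namespace DecTree
open Classical

variable {I : Type u} {E : I → Type v} {t : DecTree I E} {S : Finset t.V}
  {v d : t.V} {K : Type*} [Field K]

theorem isSplit_insert_union (hS : (S : Set t.V).OrdConnected)
    (hv : IsGreatest (S : Set t.V) v) (hd : d ∈ S) (hdv : d < v) {τ' τ'' : Finset (Finset t.V)}
    (h' : τ' ∈ DecForest.binTub (S.filter (¬ · ≤ d)))
    (h'' : τ'' ∈ DecForest.binTub (S.filter (· ≤ d))) :
    IsSplit S (S.filter (¬ · ≤ d)) (S.filter (· ≤ d)) (insert S (τ' ∪ τ'')) τ' τ'' where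
  left_mem := DecForest.self_mem_of_mem_binTub (DecForest.isTube_filter_not_le hS hv hdv) h'
  right_mem := DecForest.self_mem_of_mem_binTub (DecForest.isTube_filter_le hS hd) h''
  left_sub _ hZ := DecForest.subset_of_mem_binTub h' hZ
  right_sub _ hZ := DecForest.subset_of_mem_binTub h'' hZ
  left_nonempty _ hZ := (DecForest.isTube_of_mem_binTub h' hZ).nonempty
  right_nonempty _ hZ := (DecForest.isTube_of_mem_binTub h'' hZ).nonempty
  disj := DecForest.disjoint_filter_le
  union_eq := DecForest.filter_not_le_union
  mem_iff Z := by simp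

theorem mem_filter_not_le_of_le {x y : t.V} (hx : x ∈ S.filter (¬ · ≤ d)) (hy : y ∈ S)
    (hxy : x ≤ y) : y ∈ S.filter (¬ · ≤ d) :=
  Finset.mem_filter.2 ⟨hy, fun h => (Finset.mem_filter.1 hx).2 (hxy.trans h)⟩

theorem isGreatest_root (hr : t.root ∈ S) : IsGreatest (S : Set t.V) t.root :=
  ⟨hr, fun x _ => t.le_root x⟩

theorem b_singleton : t.b {{t.root}} = 1 := by
  rw [b, Finset.filter_true_of_mem, Finset.card_singleton]
  simp

theorem constantCoeff_branchProd (hS : (S : Set t.V).OrdConnected)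
    (hv : IsGreatest (S : Set t.V) v) (hne : S ≠ {v}) {p : t.V → K[X]}
    (hp : ∀ u, (p u).coeff 0 = 0) :
    MvPolynomial.constantCoeff (t.branchProd S p v) = 0 := by
  obtain ⟨x, hx, hxv⟩ : ∃ x ∈ S, x ≠ v := by
    by_contra! h
    exact hne (Finset.eq_singleton_iff_unique_mem.2 ⟨hv.1, h⟩)
  obtain ⟨c, hxc, hcv⟩ := exists_le_covBy_of_lt (lt_of_le_of_ne (hv.2 hx) hxv)
  have hc : c ∈ S := hS.out hx hv.1 ⟨hxc, hcv.le⟩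
  rw [DecForest.branchProd_eq_prod, map_prod, Finset.prod_eq_zero (Finset.mem_univ c)]
  rw [DecForest.branchFactor, dif_pos ⟨hcv, hc⟩]
  have hq : ∀ q : K[X], MvPolynomial.constantCoeff
      (Polynomial.aeval (MvPolynomial.X (t.edec c v hcv) : MvPolynomial _ K) q) = q.coeff 0 := by
    intro q
    induction q using Polynomial.induction_on' with
    | add p q hp hq => rw [map_add, map_add, hp, hq, Polynomial.coeff_add]
    | monomial n c =>
      rw [Polynomial.aeval_monomial, map_mul, map_pow, MvPolynomial.constantCoeff_X,
        MvPolynomial.algebraMap_eq, MvPolynomial.constantCoeff_C, Polynomial.coeff_monomial]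
      cases n <;> simp
  rw [hq, hp]

theorem val_filter_le (Λ : ∀ i, MvPolynomial (E i) K →ₗ[K] K[X]) (S : Finset t.V) (d : t.V) :
    t.val Λ (S.filter (· ≤ d)) d = t.val Λ S d :=
  DecForest.val_congr Λ fun x hx => by simp [hx.le]

variable [∀ i, Fintype (E i)] (a : ∀ i, (E i →₀ ℕ) → K)

/-- The Mellin monomial of a tubing of a tube `S` with root `v`. -/
noncomputable def melOn (S : Finset t.V) (v : t.V) (τ : Finset (Finset t.V)) : K :=
  ∏ u ∈ S.erase v, a (t.vdec u) (t.rk τ u)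

theorem melOn_insert_union (hS : (S : Set t.V).OrdConnected)
    (hv : IsGreatest (S : Set t.V) v) (hd : d ∈ S) (hdv : d < v) {τ' τ'' : Finset (Finset t.V)}
    (h' : τ' ∈ DecForest.binTub (S.filter (¬ · ≤ d)))
    (h'' : τ'' ∈ DecForest.binTub (S.filter (· ≤ d))) :
    melOn a S v (insert S (τ' ∪ τ'')) = melOn a (S.filter (¬ · ≤ d)) v τ' *
      (melOn a (S.filter (· ≤ d)) d τ'' * a (t.vdec d) (t.rk τ'' d)) := by
  have h := isSplit_insert_union hS hv hd hdv h' h''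
  have hdY := DecForest.isGreatest_filter_le (A := t.toDecForest) hd
  have hvX := DecForest.isGreatest_filter_not_le (A := t.toDecForest) hv hdv
  have hlow : ∃ y ∈ S.filter (· ≤ d), ∃ x ∈ S.filter (¬ · ≤ d), y ≤ x :=
    ⟨d, hdY.1, v, hvX.1, hdv.le⟩
  have h1 : S.erase v = (S.filter (¬ · ≤ d)).erase v ∪ S.filter (· ≤ d) := by
    nth_rewrite 1 [← DecForest.filter_not_le_union (A := t.toDecForest) (S := S) (d := d)]
    rw [Finset.erase_union_distrib, Finset.erase_eq_of_notMem (a := v) (s := S.filter (· ≤ d))]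
    exact fun h => not_le_of_gt hdv (Finset.mem_filter.1 h).2
  rw [melOn, h1, Finset.prod_union
    (Finset.disjoint_of_subset_left (Finset.erase_subset _ _) h.disj)]
  congr 1
  · refine Finset.prod_congr rfl fun u hu => ?_
    rw [rk_left h (fun x hx y hy => mem_filter_not_le_of_le hx hy) hlow hdY
      (Finset.mem_of_mem_erase hu) fun hg => Finset.ne_of_mem_erase hu (hg.unique hvX)]
  · rw [melOn, mul_comm, Finset.mul_prod_erase _ (fun u => a (t.vdec u) (t.rk τ'' u)) hdY.1]
    refine Finset.prod_congr rfl fun u hu => ?_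
    rw [rk_right h (fun x hx y hy => mem_filter_not_le_of_le hx hy) hlow hdY hu]

/-- The generating polynomial of the rank vectors at the root of the binary tubings of `S`. -/
noncomputable def rankPoly (S : Finset t.V) (v : t.V) : MvPolynomial (E (t.vdec v)) K :=
  ∑ τ ∈ DecForest.binTub S, MvPolynomial.monomial (t.rk τ v) (melOn a S v τ)

theorem monomialForm_rankPoly (S : Finset t.V) (v : t.V) :
    monomialForm (a (t.vdec v)) (rankPoly a S v) =
      ∑ τ ∈ DecForest.binTub S, melOn a S v τ * a (t.vdec v) (t.rk τ v) := by
  simp only [rankPoly, map_sum, monomialForm_monomial]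

theorem rk_singleton (v : t.V) : t.rk {{v}} v = 0 := by
  ext e
  rw [rk_apply, Finsupp.zero_apply, Finset.card_eq_zero, Finset.filter_eq_empty_iff]
  rintro Z - ⟨⟨hZ, Q, ⟨hQ, hZQ, -⟩, -⟩, -⟩
  rw [Finset.mem_singleton] at hZ hQ
  exact hZQ.ne (hZ.trans hQ.symm)

theorem rankPoly_singleton (v : t.V) : rankPoly a ({v} : Finset t.V) v = 1 := by
  rw [rankPoly, DecForest.binTub_singleton, Finset.sum_singleton, rk_singleton, melOn]
  simp

theorem rankPoly_eq (hS : (S : Set t.V).OrdConnected) (hv : IsGreatest (S : Set t.V) v)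
    (hne : S ≠ {v}) : rankPoly a S v = ∑ e, MvPolynomial.X e * ∑ d ∈ S with t.Toward v d e,
      monomialForm (a (t.vdec d)) (rankPoly a (S.filter (· ≤ d)) d) •
        rankPoly a (S.filter (¬ · ≤ d)) v := by
  rw [rankPoly, DecForest.sum_binTub hS hv hne, ← DecForest.sum_toward]
  refine Finset.sum_congr rfl fun e _ => ?_
  rw [Finset.mul_sum]
  refine Finset.sum_congr rfl fun d hd => ?_
  obtain ⟨hd, he⟩ := Finset.mem_filter.1 hd
  rw [monomialForm_rankPoly, rankPoly, Finset.smul_sum, Finset.mul_sum]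
  refine Finset.sum_congr rfl fun τ' h' => ?_
  rw [Finset.sum_smul, Finset.mul_sum]
  refine Finset.sum_congr rfl fun τ'' h'' => ?_
  have h := isSplit_insert_union hS hv hd he.lt h' h''
  have hdY := DecForest.isGreatest_filter_le (A := t.toDecForest) hd
  have hvX := DecForest.isGreatest_filter_not_le (A := t.toDecForest) hv he.lt
  rw [melOn_insert_union a hS hv hd he.lt h' h'',
    rk_greatest h (fun x hx y hy => mem_filter_not_le_of_le hx hy) ⟨d, hdY.1, v, hvX.1, he.lt.le⟩
      hdY hvX he, MvPolynomial.smul_monomial, MvPolynomial.X, MvPolynomial.monomial_mul, one_mul,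
    add_comm, smul_eq_mul, mul_comm]

/-- The cocycles with coefficients `a`. -/
noncomputable abbrev cocycles : ∀ i, MvPolynomial (E i) K →ₗ[K] K[X] :=
  fun i => seriesCocycle (multinomialSeries (a i))

theorem coeff_zero_val (S : Finset t.V) (v : t.V) :
    (t.val (cocycles a) S v).coeff 0 = 0 := by
  rw [DecForest.val_eq, coeff_zero_seriesCocycle]

/-- The polynomial in `L` attached to a binary tubing. -/
noncomputable def tubingPoly (τ : Finset (Finset t.V)) : K[X] :=
  ∑ k ∈ Finset.Icc 1 (t.b τ),
    (a (t.vdec t.root) (t.betaVec τ k) / (k.factorial : K)) • (Polynomial.X ^ k : K[X])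

theorem coeff_zero_tubingPoly (τ : Finset (Finset t.V)) : (tubingPoly a τ).coeff 0 = 0 := by
  rw [tubingPoly, Polynomial.finsetSum_coeff]
  refine Finset.sum_eq_zero fun k hk => ?_
  have := (Finset.mem_Icc.1 hk).1
  rw [Polynomial.coeff_smul, Polynomial.coeff_X_pow, if_neg (by omega), smul_zero]

variable [CharZero K]

theorem coeff_one_val (S : Finset t.V) (v : t.V) :
    (t.val (cocycles a) S v).coeff 1 = monomialForm (a (t.vdec v))
      (factorialScale (t.branchProd S (t.val (cocycles a) S) v)) := by
  rw [DecForest.val_eq, coeff_one_seriesCocycle]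

theorem factorialScale_branchProd (hS : (S : Set t.V).OrdConnected) (hv : IsGreatest (S : Set t.V) v) :
    factorialScale (t.branchProd S (t.val (cocycles a) S) v) = rankPoly a S v := by
  induction S using Finset.strongInduction generalizing v with
  | _ S ih =>
    by_cases hne : S = {v}
    · subst hne
      rw [rankPoly_singleton, DecForest.branchProd_eq_prod, Finset.prod_eq_one]
      · simpa using factorialScale_monomial (0 : E (t.vdec v) →₀ ℕ) (1 : K)
      · intro c _
        rw [DecForest.branchFactor, dif_neg]
        rintro ⟨h, h'⟩
        exact h.lt.ne (Finset.mem_singleton.1 h')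
    · rw [factorialScale_eq, constantCoeff_branchProd hS hv hne (coeff_zero_val a S), map_zero, zero_add,
        rankPoly_eq a hS hv hne]
      refine Finset.sum_congr rfl fun e _ => ?_
      rw [DecForest.pderiv_branchProd _ hS hv.1 e fun c hc _ =>
        DecForest.derivative_val _ (fun i f => derivative_seriesCocycle _ f) hS hc, map_sum]
      congr 1
      refine Finset.sum_congr rfl fun d hd => ?_
      obtain ⟨hd, he⟩ := Finset.mem_filter.1 hd
      have hdY := DecForest.isGreatest_filter_le (A := t.toDecForest) hd
      have hvX := DecForest.isGreatest_filter_not_le (A := t.toDecForest) hv he.lt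
      rw [map_smul, ih _ _ (DecForest.ordConnected_filter_not_le hS d) hvX, ← val_filter_le,
        coeff_one_val, ih _ _ (DecForest.ordConnected_filter_le hS d) hdY]
      · refine Finset.ssubset_iff_subset_ne.2 ⟨Finset.filter_subset _ _, fun h => ?_⟩
        rw [← h] at hv
        exact not_le_of_gt he.lt (Finset.mem_filter.1 hv.1).2
      · refine Finset.ssubset_iff_subset_ne.2 ⟨Finset.filter_subset _ _, fun h => ?_⟩
        rw [← h] at hd
        exact (Finset.mem_filter.1 hd).2 le_rfl

theorem coeff_one_val_eq_sum (hS : (S : Set t.V).OrdConnected)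
    (hv : IsGreatest (S : Set t.V) v) : (t.val (cocycles a) S v).coeff 1 =
      ∑ τ ∈ DecForest.binTub S, melOn a S v τ * a (t.vdec v) (t.rk τ v) := by
  rw [coeff_one_val, factorialScale_branchProd a hS hv, monomialForm_rankPoly]

theorem derivative_tubingPoly (τ : Finset (Finset t.V)) :
    (tubingPoly a τ).derivative = ∑ k ∈ Finset.range (t.b τ),
      (a (t.vdec t.root) (t.betaVec τ (k + 1)) / (k.factorial : K)) •
        (Polynomial.X ^ k : K[X]) := by
  rw [tubingPoly, sum_Icc_one_eq_sum_range, Polynomial.derivative_sum]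
  refine Finset.sum_congr rfl fun k _ => ?_
  have h1 : (k.factorial : K) ≠ 0 := Nat.cast_ne_zero.2 k.factorial_ne_zero
  have h2 : (k : K) + 1 ≠ 0 := Nat.cast_add_one_ne_zero k
  rw [Polynomial.derivative_smul, Polynomial.derivative_X_pow, Nat.add_sub_cancel,
    ← Polynomial.smul_eq_C_mul, smul_smul, Nat.factorial_succ]
  congr 1
  push_cast
  field_simp

theorem derivative_tubingPoly_split {X Y : Finset t.V} {τ τ' τ'' : Finset (Finset t.V)}
    (h : IsSplit S X Y τ τ' τ'')
    (hup : ∀ x ∈ X, ∀ y ∈ S, x ≤ y → y ∈ X) (hlow : ∃ y ∈ Y, ∃ x ∈ X, y ≤ x)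
    (hd : IsGreatest (Y : Set t.V) d) (hX : t.root ∈ X) :
    (tubingPoly a τ).derivative =
      Polynomial.C (a (t.vdec t.root) (t.rk τ t.root)) + tubingPoly a τ' := by
  rw [derivative_tubingPoly, b_split h hX, Finset.sum_range_succ', tubingPoly,
    sum_Icc_one_eq_sum_range, add_comm, zero_add, betaVec_one]
  congr 1
  · simp [Polynomial.smul_eq_C_mul]
  · refine Finset.sum_congr rfl fun k _ => ?_
    rw [betaVec_split h hup hlow hd hX]

theorem derivative_tubingPoly_singleton :
    (tubingPoly a ({{t.root}} : Finset (Finset t.V))).derivative =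
      Polynomial.C (a (t.vdec t.root) (t.rk {{t.root}} t.root)) := by
  rw [derivative_tubingPoly, b_singleton, Finset.sum_range_one, betaVec_one]
  simp [Polynomial.smul_eq_C_mul]

theorem derivative_sum_tubingPoly (hS : (S : Set t.V).OrdConnected) (hr : t.root ∈ S) :
    (∑ τ ∈ DecForest.binTub S, melOn a S t.root τ • tubingPoly a τ).derivative =
      Polynomial.C (∑ τ ∈ DecForest.binTub S, melOn a S t.root τ *
        a (t.vdec t.root) (t.rk τ t.root)) +
      ∑ d ∈ S with d < t.root, (∑ τ'' ∈ DecForest.binTub (S.filter (· ≤ d)),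
        melOn a (S.filter (· ≤ d)) d τ'' * a (t.vdec d) (t.rk τ'' d)) •
          ∑ τ' ∈ DecForest.binTub (S.filter (¬ · ≤ d)),
            melOn a (S.filter (¬ · ≤ d)) t.root τ' • tubingPoly a τ' := by
  have hv := isGreatest_root hr
  by_cases hne : S = {t.root}
  · subst hne
    rw [DecForest.binTub_singleton, Finset.sum_singleton, Finset.sum_singleton,
      Polynomial.derivative_smul, derivative_tubingPoly_singleton, Finset.filter_false_of_mem,
      Finset.sum_empty, add_zero, Polynomial.smul_C, smul_eq_mul]
    intro d hd
    rw [Finset.mem_singleton.1 hd]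
    exact lt_irrefl _
  · rw [DecForest.sum_binTub hS hv hne, DecForest.sum_binTub hS hv hne, map_sum, map_sum,
      ← Finset.sum_add_distrib]
    refine Finset.sum_congr rfl fun d hd => ?_
    obtain ⟨hd, hdv⟩ := Finset.mem_filter.1 hd
    have hdY := DecForest.isGreatest_filter_le (A := t.toDecForest) hd
    have hvX := DecForest.isGreatest_filter_not_le (A := t.toDecForest) hv hdv
    rw [map_sum, map_sum, Finset.smul_sum, ← Finset.sum_add_distrib]
    refine Finset.sum_congr rfl fun τ' h' => ?_
    rw [map_sum, map_sum, Finset.sum_smul, ← Finset.sum_add_distrib]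
    refine Finset.sum_congr rfl fun τ'' h'' => ?_
    rw [Polynomial.derivative_smul, derivative_tubingPoly_split a
      (isSplit_insert_union hS hv hd hdv h' h'') (fun x hx y hy => mem_filter_not_le_of_le hx hy)
      ⟨d, hdY.1, t.root, hvX.1, hdv.le⟩ hdY hvX.1, smul_add, Polynomial.smul_C, smul_eq_mul]
    congr 1
    rw [melOn_insert_union a hS hv hd hdv h' h'', smul_smul, mul_comm]

theorem val_root_eq_sum (hS : (S : Set t.V).OrdConnected) (hr : t.root ∈ S) :
    t.val (cocycles a) S t.root =
      ∑ τ ∈ DecForest.binTub S, melOn a S t.root τ • tubingPoly a τ := by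
  induction S using Finset.strongInduction with
  | _ S ih =>
    refine Polynomial.ext_of_derivative ?_ ?_
    · rw [derivative_sum_tubingPoly a hS hr,
        DecForest.derivative_val _ (fun i f => derivative_seriesCocycle _ f) hS hr,
        coeff_one_val_eq_sum a hS (isGreatest_root hr)]
      congr 1
      refine Finset.sum_congr rfl fun d hd => ?_
      obtain ⟨hd, hdv⟩ := Finset.mem_filter.1 hd
      have hvX := DecForest.isGreatest_filter_not_le (A := t.toDecForest) (isGreatest_root hr) hdv
      rw [← val_filter_le, coeff_one_val_eq_sum a (DecForest.ordConnected_filter_le hS d)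
        (DecForest.isGreatest_filter_le (A := t.toDecForest) hd),
        ih _ _ (DecForest.ordConnected_filter_not_le hS d) hvX.1]
      exact Finset.filter_ssubset.2 ⟨d, hd, fun h => h le_rfl⟩
    · rw [coeff_zero_val, Polynomial.finsetSum_coeff]
      refine (Finset.sum_eq_zero fun τ _ => ?_).symm
      rw [Polynomial.coeff_smul, coeff_zero_tubingPoly, smul_zero]

theorem val_univ_root :
    t.val (cocycles a) Finset.univ t.root = ∑ τ ∈ Tub t.V, t.mel τ a •
      ∑ k ∈ Finset.Icc 1 (t.b τ), (a (t.vdec t.root) (t.betaVec τ k) / (k.factorial : K)) •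
        (Polynomial.X ^ k : K[X]) := by
  rw [val_root_eq_sum a (by simp [Set.ordConnected_univ]) (Finset.mem_univ _),
    DecForest.Tub_eq_binTub]
  refine Finset.sum_congr rfl fun τ _ => ?_
  rw [tubingPoly, melOn, mel, Finset.filter_ne']

end DecTree

/-! ### Induction on forests -/

namespace DecForest

variable {I : Type u} {E : I → Type v}

theorem Iso.of_map {A B : DecForest I E} (g : A.V → B.V) (hle : ∀ x y, g x ≤ g y ↔ x ≤ y)
    (hs : Function.Surjective g) (hv : ∀ x, B.vdec (g x) = A.vdec x)
    (he : ∀ (x y : A.V) (h : x ⋖ y) (h' : g x ⋖ g y), B.edge h' = A.edge h) : Iso A B :=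
  ⟨⟨Equiv.ofBijective g ⟨fun x y h => le_antisymm ((hle x y).1 h.le) ((hle y x).1 h.ge), hs⟩,
    hle _ _⟩, hv, he⟩

theorem covBy_of_isLowerSet {P : Type*} [PartialOrder P] {S : Set P} (hS : IsLowerSet S) {x y : S}
    (h : x ⋖ y) : (x : P) ⋖ y :=
  ⟨h.1, fun z h1 h2 => h.2 (c := ⟨z, hS h2.le y.2⟩) h1 h2⟩

open Classical in
/-- The restriction of a forest to a lower set. -/
noncomputable def restrict (A : DecForest I E) (S : Set A.V) (hS : IsLowerSet S) :
    DecForest I E where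
  V := S
  forest _ _ _ h h' :=
    Subtype.ext (A.forest _ _ _ (covBy_of_isLowerSet hS h) (covBy_of_isLowerSet hS h'))
  vdec x := A.vdec x
  edec x y h := A.edec x y (covBy_of_isLowerSet hS h)

theorem isLowerSet_toward (A : DecForest I E) (r : A.V) (e : E (A.vdec r)) :
    IsLowerSet {x | A.Toward r x e} := by
  rintro x y hyx ⟨c, hc, hxc, he⟩
  exact ⟨c, hc, hyx.trans hxc, he⟩

theorem iso_graft (A : DecForest I E) [∀ i, Fintype (E i)] (r : A.V) (hr : ∀ x, x ≤ r) :
    Iso (graft (A.vdec r) fun e => A.restrict _ (A.isLowerSet_toward r e)).toDecForest A := by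
  let g : WithTop (Σ e, {x // A.Toward r x e}) → A.V := fun x => match x with
    | none => r
    | some x => x.2.1
  refine Iso.of_map (A := (graft (A.vdec r) fun e =>
    A.restrict _ (A.isLowerSet_toward r e)).toDecForest) g ?_ ?_ ?_ ?_
  · rintro (_ | ⟨e, x, hx⟩) (_ | ⟨e', y, hy⟩)
    · exact ⟨fun _ => le_rfl, fun _ => le_rfl⟩
    · refine ⟨fun h => ?_, fun h => ?_⟩
      · exact absurd (hy.lt.trans_le h) (lt_irrefl _)
      · exact absurd h (not_le_of_gt (WithTop.coe_lt_top (α := Σ e, {x // A.Toward r x e}) _))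
    · exact ⟨fun _ => le_top (α := WithTop (Σ e, {x // A.Toward r x e})), fun _ => hr _⟩
    · have h1 : ((⟨e, x, hx⟩ : Σ e, {x // A.Toward r x e}) : WithTop (Σ e, {x // A.Toward r x e})) ≤
          (⟨e', y, hy⟩ : Σ e, {x // A.Toward r x e}) ↔
          (⟨e, x, hx⟩ : Σ e, {x // A.Toward r x e}) ≤ ⟨e', y, hy⟩ := WithTop.coe_le_coe
      refine Iff.trans ?_ h1.symm
      constructor
      · intro h
        have h2 : x ≤ y := h
        obtain rfl : e = e' := Toward.unique hx (A.isLowerSet_toward r e' h2 hy)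
        exact Sigma.mk_le_mk_iff.2 h2
      · rintro ⟨_, _, _, h⟩
        exact h
  · intro x
    rcases (hr x).eq_or_lt with rfl | hx
    · exact ⟨none, rfl⟩
    · obtain ⟨e, he⟩ := exists_toward hx
      exact ⟨some ⟨e, x, he⟩, rfl⟩
  · rintro (_ | ⟨e, x⟩)
    · rfl
    · rfl
  · rintro (_ | ⟨e, x, hx⟩) (_ | ⟨e', y, hy⟩) h h'
    · exact absurd h'.1 (lt_irrefl _)
    · exact absurd h.1 (not_lt_of_ge (le_top (α := WithTop (Σ e, {x // A.Toward r x e}))))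
    · have h1 : x ⋖ r := h'
      have h2 : A.edec x r h1 = e :=
        Toward.unique ⟨x, h1, le_rfl, rfl⟩ hx
      exact Sigma.ext rfl (heq_of_eq h2)
    · obtain rfl : e = e' := fst_eq_of_covBy h
      rfl

theorem isLowerSet_not_le (A : DecForest I E) {v : A.V} (hv : IsMax v) :
    IsLowerSet {x | ¬ x ≤ v} := by
  intro x y hyx hx hyv
  rcases A.le_or_le hyx hyv with h | h
  · exact hx h
  · exact hx (hv h)

theorem iso_union (A : DecForest I E) {v : A.V} (hv : IsMax v) :
    Iso ((A.restrict _ (isLowerSet_Iic v)).union (A.restrict _ (A.isLowerSet_not_le hv))) A := by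
  refine Iso.of_map (A := (A.restrict _ (isLowerSet_Iic v)).union
    (A.restrict _ (A.isLowerSet_not_le hv))) (Sum.elim Subtype.val Subtype.val) ?_ ?_ ?_ ?_
  · rintro (x | x) (y | y)
    · exact ⟨fun h => Sum.inl_le_inl_iff.2 (show x ≤ y from h), fun h => show x ≤ y from Sum.inl_le_inl_iff.1 h⟩
    · exact ⟨fun h => absurd x.2 (A.isLowerSet_not_le hv h y.2),
        fun h => absurd h Sum.not_inl_le_inr⟩
    · exact ⟨fun h => absurd (h.trans y.2) x.2, fun h => absurd h Sum.not_inr_le_inl⟩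
    · exact ⟨fun h => Sum.inr_le_inr_iff.2 (show x ≤ y from h), fun h => show x ≤ y from Sum.inr_le_inr_iff.1 h⟩
  · intro x
    by_cases hx : x ≤ v
    · exact ⟨Sum.inl ⟨x, hx⟩, rfl⟩
    · exact ⟨Sum.inr ⟨x, hx⟩, rfl⟩
  · rintro (x | x) <;> rfl
  · rintro (x | x) (y | y) h h'
    · rfl
    · exact absurd h.1 Sum.not_inl_lt_inr
    · exact absurd h.1 Sum.not_inr_lt_inl
    · rfl

theorem iso_empty (A : DecForest I E) [IsEmpty A.V] : Iso (empty I E) A :=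
  Iso.of_map (A := empty I E) PEmpty.elim (fun x => x.elim) (fun x => isEmptyElim x)
    (fun x => x.elim) fun x => x.elim

end DecForest

theorem ForestClass.induction {I : Type u} {E : I → Type v} [∀ i, Fintype (E i)]
    {P : ForestClass I E → Prop} (one : P 1) (mul : ∀ x y, P x → P y → P (x * y))
    (graft : ∀ i F, (∀ e, P (F e)) → P (ForestClass.graft i F)) (x : ForestClass I E) : P x := by
  have key : ∀ (n : ℕ) (A : DecForest I E), Nat.card A.V = n → P (ForestClass.mk A) := by
    intro n
    induction n using Nat.strong_induction_on with
    | _ n ih =>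
      rintro A rfl
      rcases isEmpty_or_nonempty A.V with h | ⟨⟨x⟩⟩
      · rw [← show ForestClass.mk (DecForest.empty I E) = ForestClass.mk A from
          Quotient.sound A.iso_empty]
        exact one
      obtain ⟨v, -, hv⟩ := Finite.exists_le_maximal (p := fun _ : A.V => True) (a := x) trivial
      have hv : IsMax v := fun y hy => hv.2 trivial hy
      have hcard : ∀ (S : Set A.V) (hS : IsLowerSet S) (y : A.V), y ∉ S →
          P (ForestClass.mk (A.restrict S hS)) := fun S hS y hy =>
        ih _ (Finite.card_subtype_lt (p := (· ∈ S)) hy) _ rfl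
      by_cases htop : ∀ y, y ≤ v
      · rw [← show _ = ForestClass.mk A from Quotient.sound (A.iso_graft v htop)]
        have h1 := graft (A.vdec v)
          (fun e => ForestClass.mk (A.restrict _ (A.isLowerSet_toward v e)))
          fun e => hcard _ _ v fun h => lt_irrefl _ (DecForest.Toward.lt h)
        rwa [ForestClass.graft_mk] at h1
      · push Not at htop
        obtain ⟨y, hy⟩ := htop
        rw [← show _ = ForestClass.mk A from Quotient.sound (A.iso_union hv)]
        exact mul _ _ (hcard _ _ y hy) (hcard {x | ¬ x ≤ v} _ v fun h => h le_rfl)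
  obtain ⟨A, rfl⟩ := Quotient.exists_rep x
  exact key _ A rfl

/-! ### The algebra morphism -/

namespace DecForest
open Classical

variable {I : Type u} {E : I → Type v} {K : Type*} [Field K]
  (Λ : ∀ i, MvPolynomial (E i) K →ₗ[K] K[X])

theorem apply_prod_congr {ι κ : Type*} [Fintype ι] [Fintype κ] (g : ι ≃ κ) {i j : I} (hij : j = i)
    {s : ι → E i} {s' : κ → E j} (hs : ∀ c, (⟨j, s' (g c)⟩ : Σ i, E i) = ⟨i, s c⟩)
    {p : ι → K[X]} {p' : κ → K[X]} (hp : ∀ c, p' (g c) = p c) :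
    Λ j (∏ c, Polynomial.aeval (MvPolynomial.X (s' c)) (p' c)) =
      Λ i (∏ c, Polynomial.aeval (MvPolynomial.X (s c)) (p c)) := by
  subst hij
  congr 1
  refine (Fintype.prod_equiv g _ _ fun c => ?_).symm
  rw [hp, eq_of_heq (Sigma.mk.inj (hs c)).2]

theorem val_map {A B : DecForest I E} (g : A.V → B.V) (hle : ∀ x y, g x ≤ g y ↔ x ≤ y)
    (hlow : ∀ x y, y ≤ g x → ∃ z, g z = y) (hv : ∀ x, B.vdec (g x) = A.vdec x)
    (he : ∀ (x y : A.V) (h : x ⋖ y) (h' : g x ⋖ g y), B.edge h' = A.edge h) (x : A.V) :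
    B.val Λ Finset.univ (g x) = A.val Λ Finset.univ x := by
  have hlt : ∀ x y, g x < g y ↔ x < y := fun x y => by
    rw [lt_iff_le_not_ge, lt_iff_le_not_ge, hle, hle]
  have hcov : ∀ x y, g x ⋖ g y ↔ x ⋖ y := by
    intro x y
    constructor
    · exact fun h => ⟨(hlt x y).1 h.1, fun z h1 h2 => h.2 ((hlt x z).2 h1) ((hlt z y).2 h2)⟩
    · refine fun h => ⟨(hlt x y).2 h.1, fun z h1 h2 => ?_⟩
      obtain ⟨z, rfl⟩ := hlow y z h2.le
      exact h.2 ((hlt x z).1 h1) ((hlt z y).1 h2)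
  have hinj : Function.Injective g :=
    fun x y h => le_antisymm ((hle x y).1 h.le) ((hle y x).1 h.ge)
  induction x using (wellFounded_lt (α := A.V)).induction with
  | _ x ih =>
    let f : {c // c ⋖ x ∧ c ∈ Finset.univ} → {c // c ⋖ g x ∧ c ∈ Finset.univ} :=
      fun c => ⟨g c, (hcov _ _).2 c.2.1, Finset.mem_univ _⟩
    have hf : Function.Bijective f := by
      refine ⟨fun c c' h => Subtype.ext (hinj (congrArg Subtype.val h)), ?_⟩
      rintro ⟨c, hc, hc'⟩
      obtain ⟨z, rfl⟩ := hlow x c hc.le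
      exact ⟨⟨z, (hcov _ _).1 hc, Finset.mem_univ _⟩, rfl⟩
    rw [val_eq, val_eq]
    exact apply_prod_congr Λ (Equiv.ofBijective f hf) (hv x)
      (s := fun c => A.edec c x c.2.1) (s' := fun c => B.edec c (g x) c.2.1)
      (fun c => he c x c.2.1 ((hcov _ _).2 c.2.1)) fun c => ih c c.2.1.lt

/-- The polynomial of a forest: the product of the polynomials of its components. -/
noncomputable def eval (A : DecForest I E) : K[X] :=
  ∏ v, if IsMax v then A.val Λ Finset.univ v else 1

theorem eval_congr {A B : DecForest I E} (h : Iso A B) : A.eval Λ = B.eval Λ := by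
  obtain ⟨f, hv, he⟩ := h
  refine Fintype.prod_equiv f.toEquiv _ _ fun x => ?_
  have h1 : B.val Λ Finset.univ (f x) = A.val Λ Finset.univ x :=
    val_map Λ f (fun _ _ => f.le_iff_le) (fun x y _ => f.surjective y) hv he x
  have h2 : IsMax (f x) ↔ IsMax x := f.isMax_apply
  change _ = if IsMax (f x) then B.val Λ Finset.univ (f x) else 1
  simp only [h1, h2]

theorem eval_empty : (empty I E).eval Λ = 1 :=
  Finset.prod_of_isEmpty (ι := PEmpty) _

theorem eval_union (A B : DecForest I E) : (A.union B).eval Λ = A.eval Λ * B.eval Λ := by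
  have hA : ∀ x : A.V, (A.union B).val Λ Finset.univ (Sum.inl x) = A.val Λ Finset.univ x :=
    val_map Λ (B := A.union B) Sum.inl (fun _ _ => Sum.inl_le_inl_iff)
      (by
        rintro x (y | y) h
        · exact ⟨y, rfl⟩
        · exact absurd h Sum.not_inr_le_inl) (fun _ => rfl) fun _ _ _ _ => rfl
  have hB : ∀ x : B.V, (A.union B).val Λ Finset.univ (Sum.inr x) = B.val Λ Finset.univ x :=
    val_map Λ (B := A.union B) Sum.inr (fun _ _ => Sum.inr_le_inr_iff)
      (by
        rintro x (y | y) h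
        · exact absurd h Sum.not_inl_le_inr
        · exact ⟨y, rfl⟩) (fun _ => rfl) fun _ _ _ _ => rfl
  have hmA : ∀ x : A.V, IsMax (α := A.V ⊕ B.V) (Sum.inl x) ↔ IsMax x := by
    refine fun x => ⟨fun h y hy => Sum.inl_le_inl_iff.1 (h (Sum.inl_le_inl_iff.2 hy)), ?_⟩
    rintro h (y | y) hy
    · exact Sum.inl_le_inl_iff.2 (h (Sum.inl_le_inl_iff.1 hy))
    · exact absurd hy Sum.not_inl_le_inr
  have hmB : ∀ x : B.V, IsMax (α := A.V ⊕ B.V) (Sum.inr x) ↔ IsMax x := by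
    refine fun x => ⟨fun h y hy => Sum.inr_le_inr_iff.1 (h (Sum.inr_le_inr_iff.2 hy)), ?_⟩
    rintro h (y | y) hy
    · exact absurd hy Sum.not_inr_le_inl
    · exact Sum.inr_le_inr_iff.2 (h (Sum.inr_le_inr_iff.1 hy))
  refine (Fintype.prod_sum_type (α₁ := A.V) (α₂ := B.V) _).trans ?_
  congr 1
  · exact Finset.prod_congr rfl fun x _ => if_congr (hmA x) (hA x) rfl
  · exact Finset.prod_congr rfl fun x _ => if_congr (hmB x) (hB x) rfl

theorem eval_of_greatest (A : DecForest I E) (r : A.V) (hr : ∀ x, x ≤ r) :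
    A.eval Λ = A.val Λ Finset.univ r := by
  have hm : IsMax r := fun x _ => hr x
  rw [eval, Finset.prod_eq_single r, if_pos hm]
  · intro x _ hx
    exact if_neg fun h => hx (le_antisymm (hr x) (h (hr x)))
  · simp

theorem eval_graft (i : I) [Fintype (E i)] (F : E i → DecForest I E) :
    (graft i F).eval Λ = Λ i (∏ e, Polynomial.aeval (MvPolynomial.X e) ((F e).eval Λ)) := by
  have hF : ∀ e (x : (F e).V), (graft i F).val Λ Finset.univ
      ((⟨e, x⟩ : Σ e, (F e).V) : WithTop (Σ e, (F e).V)) = (F e).val Λ Finset.univ x := by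
    intro e
    refine val_map Λ (B := (graft i F).toDecForest)
      (fun x => ((⟨e, x⟩ : Σ e, (F e).V) : WithTop (Σ e, (F e).V))) ?_ ?_ (fun _ => rfl)
      fun _ _ _ _ => rfl
    · exact fun x y => WithTop.coe_le_coe.trans Sigma.mk_le_mk_iff
    · rintro x (_ | ⟨e', y⟩) h
      · exact absurd h (not_le_of_gt (WithTop.coe_lt_top (α := Σ e, (F e).V) _))
      · obtain rfl : e' = e := (Sigma.le_def.1 (WithTop.coe_le_coe.1 h)).fst
        exact ⟨y, rfl⟩
  have hcov : ∀ e (x : (F e).V), ((⟨e, x⟩ : Σ e, (F e).V) : WithTop (Σ e, (F e).V)) ⋖ ⊤ ↔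
      IsMax x := by
    intro e x
    constructor
    · intro h y hxy
      by_contra hyx
      exact h.2 (WithTop.coe_lt_coe.2 (Sigma.mk_lt_mk_iff.2 (lt_of_le_not_ge hxy hyx)))
        (WithTop.coe_lt_top (⟨e, y⟩ : Σ e, (F e).V))
    · refine fun h => ⟨WithTop.coe_lt_top _, ?_⟩
      rintro (_ | ⟨e', y⟩) h1 h2
      · exact lt_irrefl _ h2
      · have h3 := WithTop.coe_lt_coe.1 h1
        obtain rfl : e = e' := (Sigma.lt_def.1 h3).fst
        exact (Sigma.mk_lt_mk_iff.1 h3).not_ge (h (Sigma.mk_lt_mk_iff.1 h3).le)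
  rw [eval_of_greatest Λ _ (graft i F).root (graft i F).le_root, val_eq]
  let G : WithTop (Σ e, (F e).V) → MvPolynomial (E i) K := fun x =>
    (graft i F).branchFactor Finset.univ ((graft i F).val Λ Finset.univ) (graft i F).root x
  have hG0 : G ⊤ = 1 := branchFactor_of_not_covBy fun h => lt_irrefl _ h.lt
  have hG : ∀ e (x : (F e).V), G ((⟨e, x⟩ : Σ e, (F e).V) : WithTop (Σ e, (F e).V)) =
      Polynomial.aeval (MvPolynomial.X e)
        (if IsMax x then (F e).val Λ Finset.univ x else 1) := by
    intro e x
    by_cases hx : IsMax x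
    · rw [if_pos hx, ← hF e x]
      exact branchFactor_of_covBy ((hcov e x).2 hx) (Finset.mem_univ _)
    · rw [if_neg hx, map_one]
      exact branchFactor_of_not_covBy fun h => hx ((hcov e x).1 h)
  have key : ∏ x : Option (Σ e, (F e).V), G x =
      ∏ e, Polynomial.aeval (MvPolynomial.X e) ((F e).eval Λ) := by
    refine (Fintype.prod_option (α := Σ e, (F e).V) _).trans ?_
    refine (congrArg₂ (· * ·) hG0 (Fintype.prod_sigma _)).trans ((one_mul _).trans ?_)
    refine Finset.prod_congr rfl fun e _ => ?_
    rw [eval, map_prod]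
    exact Finset.prod_congr rfl fun x _ => hG e x
  exact congrArg (Λ i) ((branchProd_eq_prod _ _ _).trans key)

end DecForest

namespace CKAlgebra

variable {I : Type u} {E : I → Type v} {K : Type*} [Field K]
  (Λ : ∀ i, MvPolynomial (E i) K →ₗ[K] K[X])

/-- The polynomial of a forest as a character of the monoid of forests. -/
noncomputable def evalClass : ForestClass I E →* K[X] where
  toFun := Quotient.lift (fun A => A.eval Λ) fun _ _ h => DecForest.eval_congr Λ h
  map_one' := DecForest.eval_empty Λ
  map_mul' := by
    rintro ⟨A⟩ ⟨B⟩
    exact DecForest.eval_union Λ A B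

/-- The algebra morphism given by the polynomials of forests. -/
noncomputable def evalHom : CKAlgebra K I E →ₐ[K] K[X] :=
  MonoidAlgebra.lift K K[X] (ForestClass I E) (evalClass Λ)

theorem evalHom_of (x : ForestClass I E) :
    evalHom Λ (MonoidAlgebra.of K (ForestClass I E) x) = evalClass Λ x :=
  MonoidAlgebra.lift_of _ _

theorem evalHom_ofForest (A : DecForest I E) : evalHom Λ (ofForest K A) = A.eval Λ :=
  evalHom_of Λ _

theorem tensorToPoly_tprod {ε : Type*} [Fintype ε] (p : ε → K[X]) :
    tensorToPoly (PiTensorProduct.tprod K p) =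
      ∏ e, Polynomial.aeval (MvPolynomial.X e : MvPolynomial ε K) (p e) := by
  rw [tensorToPoly, PiTensorProduct.lift.tprod]
  simp

variable {Λ} in
theorem comp_Bplus_eq_iff (i : I) [Fintype (E i)] (φ : CKAlgebra K I E →ₐ[K] K[X]) :
    φ.toLinearMap ∘ₗ Bplus K i =
      Λ i ∘ₗ tensorToPoly ∘ₗ PiTensorProduct.map (fun _ => φ.toLinearMap) ↔
    ∀ F : E i → ForestClass I E, φ (MonoidAlgebra.of K (ForestClass I E) (ForestClass.graft i F)) =
      Λ i (∏ e, Polynomial.aeval (MvPolynomial.X e) (φ (MonoidAlgebra.of K (ForestClass I E) (F e)))) := by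
  have h1 : ∀ F : E i → ForestClass I E,
      (Basis.piTensorProduct fun _ : E i => basis K I E) F =
        PiTensorProduct.tprod K fun e => MonoidAlgebra.of K (ForestClass I E) (F e) := by
    intro F
    rw [Basis.piTensorProduct_apply]
    rfl
  have h2 : ∀ F : E i → ForestClass I E,
      (φ.toLinearMap ∘ₗ Bplus K i) ((Basis.piTensorProduct fun _ : E i => basis K I E) F) =
        φ (MonoidAlgebra.of K (ForestClass I E) (ForestClass.graft i F)) := by
    intro F
    rw [LinearMap.comp_apply, Bplus, Module.Basis.constr_basis, AlgHom.toLinearMap_apply]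
  have h3 : ∀ F : E i → ForestClass I E,
      (Λ i ∘ₗ tensorToPoly ∘ₗ PiTensorProduct.map (fun _ => φ.toLinearMap))
        ((Basis.piTensorProduct fun _ : E i => basis K I E) F) =
      Λ i (∏ e, Polynomial.aeval (MvPolynomial.X e) (φ (MonoidAlgebra.of K (ForestClass I E) (F e)))) := by
    intro F
    rw [h1, LinearMap.comp_apply, LinearMap.comp_apply, PiTensorProduct.map_tprod,
      tensorToPoly_tprod]
    rfl
  constructor
  · intro h F
    rw [← h2, h, h3]
  · intro h
    refine (Basis.piTensorProduct fun _ : E i => basis K I E).ext fun F => ?_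
    rw [h2, h3, h]

variable [∀ i, Fintype (E i)]

theorem evalHom_comp_Bplus (i : I) : (evalHom Λ).toLinearMap ∘ₗ Bplus K i =
    Λ i ∘ₗ tensorToPoly ∘ₗ PiTensorProduct.map fun _ => (evalHom Λ).toLinearMap := by
  rw [comp_Bplus_eq_iff]
  intro F
  choose G hG using fun e => Quotient.exists_rep (F e)
  obtain rfl : (fun e => ForestClass.mk (G e)) = F := funext hG
  rw [ForestClass.graft_mk]
  simp only [evalHom_of]
  exact DecForest.eval_graft Λ i G

variable {Λ} in
theorem hom_ext_of_comp_Bplus {φ ψ : CKAlgebra K I E →ₐ[K] K[X]}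
    (hφ : ∀ i, φ.toLinearMap ∘ₗ Bplus K i =
      Λ i ∘ₗ tensorToPoly ∘ₗ PiTensorProduct.map fun _ => φ.toLinearMap)
    (hψ : ∀ i, ψ.toLinearMap ∘ₗ Bplus K i =
      Λ i ∘ₗ tensorToPoly ∘ₗ PiTensorProduct.map fun _ => ψ.toLinearMap) : φ = ψ := by
  refine MonoidAlgebra.algHom_ext (M := ForestClass I E) (A := K) (fun x => ?_)
    (Subsingleton.elim _ _)
  change φ (MonoidAlgebra.of K (ForestClass I E) x) = ψ (MonoidAlgebra.of K (ForestClass I E) x)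
  induction x using ForestClass.induction with
  | one => simp only [map_one]
  | mul x y hx hy => simp only [map_mul, hx, hy]
  | graft i F h =>
    rw [(comp_Bplus_eq_iff i φ).1 (hφ i), (comp_Bplus_eq_iff i ψ).1 (hψ i)]
    simp only [h]

end CKAlgebra

theorem mainTheorem2 {K : Type*} [Field K] [CharZero K] {I : Type u} {E : I → Type v}
    [∀ i, Fintype (E i)] (Λ : ∀ i, MvPolynomial (E i) K →ₗ[K] K[X])
    (hΛ : ∀ i, IsOneCocycle (Λ i)) :
    (∃! a : ∀ i, (E i →₀ ℕ) → K, ∀ i, Λ i = seriesCocycle (multinomialSeries (a i))) ∧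
    (∃! φ : CKAlgebra K I E →ₐ[K] K[X], ∀ i,
      φ.toLinearMap ∘ₗ CKAlgebra.Bplus K i =
        Λ i ∘ₗ tensorToPoly ∘ₗ PiTensorProduct.map fun _ => φ.toLinearMap) ∧
    ∀ (a : ∀ i, (E i →₀ ℕ) → K) (φ : CKAlgebra K I E →ₐ[K] K[X]),
      (∀ i, Λ i = seriesCocycle (multinomialSeries (a i))) →
      (∀ i, φ.toLinearMap ∘ₗ CKAlgebra.Bplus K i =
        Λ i ∘ₗ tensorToPoly ∘ₗ PiTensorProduct.map fun _ => φ.toLinearMap) →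
      ∀ t : DecTree I E,
        φ (CKAlgebra.ofForest K t.toDecForest) =
          ∑ τ ∈ Tub t.V, t.mel τ a • ∑ k ∈ Finset.Icc 1 (t.b τ),
            (a (t.vdec t.root) (t.betaVec τ k) / (k.factorial : K)) •
              (Polynomial.X ^ k : K[X]) := by
  refine ⟨?_, ⟨CKAlgebra.evalHom Λ, CKAlgebra.evalHom_comp_Bplus Λ, fun φ hφ =>
    CKAlgebra.hom_ext_of_comp_Bplus hφ (CKAlgebra.evalHom_comp_Bplus Λ)⟩, ?_⟩
  · choose a ha hu using fun i => (hΛ i).existsUnique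
    exact ⟨a, ha, fun b hb => funext fun i => hu i (b i) (hb i)⟩
  · intro a φ ha hφ t
    obtain rfl : Λ = DecTree.cocycles a := funext ha
    rw [CKAlgebra.hom_ext_of_comp_Bplus hφ (CKAlgebra.evalHom_comp_Bplus _),
      CKAlgebra.evalHom_ofForest, DecForest.eval_of_greatest _ _ t.root t.le_root,
      DecTree.val_univ_root]
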